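/- Let $H,N,k\ge 2$ be integers, let $m_1,\dots,m_H>0$ and $\widetilde m_1,\dots,\widetilde m_N>0$, and let $c_1,\dots,c_N:\mathbb R\to\mathbb R^k$ be continuous. Write $\widetilde m=\sum_{i=1}^N\widetilde m_i$, let $\|\cdot\|$ be the Euclidean norm on $\mathbb R^k$, and for $x=(q_1,\dots,q_H)$, $y=(p_1,\dots,p_H)$ in $\mathbb R^{kH}$ set $$\langle x,y\rangle=\sum_{j=1}^H m_j\,q_j\cdot p_j,\qquad |x|=\sqrt{\langle x,x\rangle},\qquad \mathcal E=\{x\in\mathbb R^{kH}:|x|=1\}.$$ Consider the restricted $(N+H)$-body problem $$m_j\ddot q_j=-\sum_{i=1}^N\frac{\widetilde m_i m_j\,(q_j-c_i(t))}{\|q_j-c_i(t)\|^3}-\sum_{l\ne j}\frac{m_l m_j\,(q_j-q_l)}{\|q_j-q_l\|^3},\qquad j=1,\dots,H, \tag{1}$$ and, on $\Sigma=\{(q_1,\dots,q_H): q_j\ne 0 \text{ for all } j,\ q_l\ne q_j \text{ for } l\ne j\}$, the potential $$U(x)=\widetilde m\sum_{j=1}^H\frac{m_j}{\|q_j\|}+\sum_{l<j}\frac{m_l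 m_j}{\|q_l-q_j\|}.$$ Suppose that $\Xi>0$ satisfies $\sup_{t\in\mathbb R}\|c_i(t)\|<\Xi$ for every $i$. Let $\xi^+\in\mathcal E\cap\Sigma$ be a central configuration for $U$, that is, a critical point of $\mathcal U=U|_{\mathcal E}$, satisfying the (BS) condition: the smallest eigenvalue $\nu_1$ of the Hessian $\nabla^2\mathcal U(\xi^+)$, taken on the tangent space of $\mathcal E$ at $\xi^+$ with respect to the scalar product $\langle\cdot,\cdot\rangle$, satisfies $\nu_1>-\tfrac18\,\mathcal U(\xi^+)$. For $R>0$ and $\eta\in\,]0,1[$ put $$\mathcal T(\xi^+,R,\eta)=\Bigl\{x\in\mathbb R^{kH}: |x|>R,\ \Bigl\langle \frac{x}{|x|},\xi^+\Bigr\rangle>\eta\Bigr\}.$$ Then for every $\eta\in\,]0,1[$ there exist $R'>\Xi+1$ and $\eta'\in[\eta,1[$ such that $\mathcal T(\xi^+,R',\eta')\subseteq\Sigma$ and, for every $x_0\in\mathcal T(\xi^+,R',\eta')$, there exists a parabolic solution $x:[0,+\infty[\,\to\mathbb R^{kH}$ of (1), that is, a collision-free solution (among the $q_j$ and with the $c_i$)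 with $|x(t)|\to+\infty$ and $\dot x(t)\to 0$ as $t\to+\infty$, such that $x(0)=x_0$, $$\lim_{t\to+\infty}\frac{x(t)}{|x(t)|}=\xi^+\qquad\text{and}\qquad |x(t)|\sim\omega\,t^{2/3}\ \text{ for } t\to+\infty,\qquad \omega=\sqrt[3]{\tfrac92\,U(\xi^+)}.$$ -/

import Mathlib

open Filter Topology Asymptotics

noncomputable section

namespace RestrictedNBody

/-- A configuration `x = (q_1, …, q_H)` of `H` bodies in Euclidean `k`-space; as a vector space
it is `ℝ^d` with `d = k * H`. -/
abbrev Configuration (H k : ℕ) : Type := Fin H → EuclideanSpace ℝ (Fin k)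

variable {N H k : ℕ}

/-- The mass scalar product `⟨x, y⟩ = ∑ j, m_j (x_j · y_j)`. -/
def massInner (m : Fin H → ℝ) (x y : Configuration H k) : ℝ :=
  ∑ j, m j * inner ℝ (x j) (y j)

/-- The norm `|x| = √⟨x, x⟩` of the mass scalar product. -/
def massNorm (m : Fin H → ℝ) (x : Configuration H k) : ℝ :=
  Real.sqrt (massInner m x x)

/-- The natural domain `Σ` of the potential: no body at the origin, no two bodies in the same
place. -/
def domain (H k : ℕ) : Set (Configuration H k) :=
  {x | (∀ j, x j ≠ 0) ∧ ∀ l j, l ≠ j → x l ≠ x j}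

/-- The potential
`U(x) = (∑ i, m̃_i) ∑ j, m_j / ‖q_j‖ + ∑_{l < j} m_l m_j / ‖q_l - q_j‖`:
Kepler part plus `H`-body part (used on `domain H k`). -/
def potential (mt : Fin N → ℝ) (m : Fin H → ℝ) (x : Configuration H k) : ℝ :=
  (∑ i, mt i) * ∑ j, m j / ‖x j‖ + ∑ j, ∑ l ∈ Finset.Iio j, m l * m j / ‖x l - x j‖

/-- `ξ` is a (normalized) central configuration: it lies in `Σ` and on the inertia ellipsoid
`ℰ = {x | |x| = 1}`, and it is a critical point of `𝒰 = U|_ℰ`, that is, the differential of `U`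
at `ξ` vanishes on the tangent space `T_ξ ℰ = {v | ⟨ξ, v⟩ = 0}`. -/
def IsCentralConfiguration (mt : Fin N → ℝ) (m : Fin H → ℝ) (ξ : Configuration H k) : Prop :=
  ξ ∈ domain H k ∧ massNorm m ξ = 1 ∧
    ∀ v : Configuration H k, massInner m ξ v = 0 → fderiv ℝ (potential mt m) ξ v = 0

/-- The function `x ↦ 𝒰(x / |x|)`: the extension of `𝒰 = U|_ℰ` that is constant along rays. -/
def radialExtension (mt : Fin N → ℝ) (m : Fin H → ℝ) (x : Configuration H k) : ℝ :=
  potential mt m ((massNorm m x)⁻¹ • x)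

/-- The Hessian of `𝒰 = U|_ℰ` at `ξ ∈ ℰ`, as a bilinear form evaluated at two tangent vectors
`v, w ∈ T_ξ ℰ`. The ellipsoid `ℰ` is the unit sphere of the mass scalar product. For a tangent
vector `v` of mass norm one, `s ↦ (ξ + s v) / |ξ + s v|` is the geodesic
`τ ↦ cos τ ξ + sin τ v` with `τ = arctan s`, and `arctan` has derivative `1` and second derivative
`0` at `0`; so on `T_ξ ℰ` the ordinary second derivative of the radial extension is the
Riemannian Hessian of `𝒰`. -/
def hessianRestricted (mt : Fin N → ℝ) (m : Fin H → ℝ) (ξ v w : Configuration H k) : ℝ :=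
  fderiv ℝ (fderiv ℝ (radialExtension mt m)) ξ v w

/-- `ν` is an eigenvalue of `∇² 𝒰(ξ)`, the endomorphism of `T_ξ ℰ` which represents the Hessian
of `𝒰` with respect to the mass scalar product: `∇² 𝒰(ξ) v = ν v` for a nonzero `v ∈ T_ξ ℰ`. -/
def IsHessianEigenvalue (mt : Fin N → ℝ) (m : Fin H → ℝ) (ξ : Configuration H k) (ν : ℝ) : Prop :=
  ∃ v : Configuration H k, v ≠ 0 ∧ massInner m ξ v = 0 ∧
    ∀ w : Configuration H k, massInner m ξ w = 0 →
      hessianRestricted mt m ξ v w = ν * massInner m v w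

/-- The Barutello–Secchi condition: the smallest eigenvalue `ν₁` of `∇² 𝒰(ξ)` satisfies
`ν₁ > - ((2 - α)² / 8) 𝒰(ξ)`, with `α = 1` for the Newtonian potential. -/
def BSCondition (mt : Fin N → ℝ) (m : Fin H → ℝ) (ξ : Configuration H k) : Prop :=
  ∃ ν₁ : ℝ, IsLeast {ν | IsHessianEigenvalue mt m ξ ν} ν₁ ∧
    ν₁ > -((2 - 1) ^ 2 / 8) * potential mt m ξ

/-- The truncated cone `𝒯(ξ, R, η) = {x | |x| > R and ⟨x / |x|, ξ⟩ > η}`. -/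
def truncatedCone (m : Fin H → ℝ) (ξ : Configuration H k) (R η : ℝ) : Set (Configuration H k) :=
  {x | massNorm m x > R ∧ massInner m ((massNorm m x)⁻¹ • x) ξ > η}

/-- The force on the `j`-th body of the configuration `q`, when the primaries are at the points
`c i`. -/
def force (mt : Fin N → ℝ) (m : Fin H → ℝ) (c : Fin N → EuclideanSpace ℝ (Fin k))
    (q : Configuration H k) (j : Fin H) : EuclideanSpace ℝ (Fin k) :=
  -(∑ i, (mt i * m j / ‖q j - c i‖ ^ 3) • (q j - c i)) -
    ∑ l ∈ Finset.univ.erase j, (m l * m j / ‖q j - q l‖ ^ 3) • (q j - q l)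

/-- `x`, restricted to `[0, +∞)`, is a solution with velocity `v` of the restricted
`(N+H)`-body problem `m_j q̈_j = force_j`: at all times `t ≥ 0` it is free of collisions, among
the `H` bodies and with the primaries, and satisfies the equation (one-sided derivatives at
`t = 0`). -/
def IsSolution (mt : Fin N → ℝ) (m : Fin H → ℝ) (c : Fin N → ℝ → EuclideanSpace ℝ (Fin k))
    (x v : ℝ → Configuration H k) : Prop :=
  ∃ a : ℝ → Configuration H k, ∀ t : ℝ, 0 ≤ t →
    (∀ l j, l ≠ j → x t l ≠ x t j) ∧ (∀ i j, x t j ≠ c i t) ∧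
    HasDerivWithinAt x (v t) (Set.Ici 0) t ∧
    HasDerivWithinAt v (a t) (Set.Ici 0) t ∧
    ∀ j, m j • a t j = force mt m (fun i => c i t) (x t) j

/-- `x` is a parabolic solution on `[0, +∞)`: it is a solution, `|x(t)| → +∞` and `ẋ(t) → 0`
as `t → +∞`. -/
def IsParabolicSolution (mt : Fin N → ℝ) (m : Fin H → ℝ)
    (c : Fin N → ℝ → EuclideanSpace ℝ (Fin k)) (x : ℝ → Configuration H k) : Prop :=
  ∃ v : ℝ → Configuration H k, IsSolution mt m c x v ∧
    Tendsto (fun t => massNorm m (x t)) atTop atTop ∧ Tendsto v atTop (𝓝 0)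

end RestrictedNBody

end

/-! In logarithmic time `u = log (1 + t / τ)` look for the orbit as `x = lam e^{2u/3} (ξ + e^{-u/6}
ψ(u))`, a perturbation of the homothetic parabolic orbit along `ξ`. The acceleration field `F` is
homogeneous of degree -2 jointly in bodies and primaries, so only the rescaled primaries `γ = c_i /
(lam e^{2u/3})` enter, and they decay exponentially. With `c = 2 / (9 U(ξ))` and `τ² = c lam³` the
equation of motion becomes `ψ'' = ψ/4 + c e^{u/6} (F(ξ + e^{-u/6} ψ, γ) - F(ξ, 0))`, without a
first-order term (`hasDerivAt_profileVelocity`).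

Let `A` be the derivative of `F(·, 0)` at `ξ`. The linear part is `1/4 + c A`, and `A` is symmetric
for the mass product. It has eigenvalue `2U(ξ)` along `ξ`, and equals the Hessian of `𝒰` minus
`U(ξ)` on the tangent space. Hence `1/4 + c A` is positive exactly when the Hessian eigenvalues
exceed `-U(ξ)/8`: the (BS) condition makes every mode hyperbolic (`eigenvalue_linearization_gt`).

A hyperbolic system `ψ'' = δ² ψ + g` on the half-line has a unique bounded solution for each initial
position, so a contraction handles the small nonlinear remainder (`exists_bounded_solution`,
`exists_profile`). Taking `lam = |x₀|` and `ψ(0) = x₀/|x₀| - ξ` gives `x(0) = x₀`. Boundedness of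
`ψ` and `ψ'` yields the limit direction, the growth of `|x|` and the vanishing of the velocity. -/

noncomputable section

namespace RestrictedNBody

variable {N H k : ℕ}

/-! ### Bounded solutions of hyperbolic systems on the half-line -/

/-- The bounded solution of `w' = δ w + g` on `[0, ∞)`, for bounded `g`. -/
def unstableSol (δ : ℝ) (g : ℝ → ℝ) (u : ℝ) : ℝ :=
  Real.exp (δ * u) * ((∫ v in (0 : ℝ)..u, Real.exp (-δ * v) * g v) -
    ∫ v in Set.Ioi (0 : ℝ), Real.exp (-δ * v) * g v)

/-- The solution of `ψ' = -δ ψ + w` with `ψ 0 = a`. -/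
def stableSol (δ a : ℝ) (w : ℝ → ℝ) (u : ℝ) : ℝ :=
  Real.exp (-δ * u) * (a + ∫ v in (0 : ℝ)..u, Real.exp (δ * v) * w v)

lemma integrableOn_exp_mul {δ M : ℝ} (hδ : 0 < δ) {g : ℝ → ℝ} (hg : Continuous g)
    (hM : ∀ u, |g u| ≤ M) (u : ℝ) :
    MeasureTheory.IntegrableOn (fun v => Real.exp (-δ * v) * g v) (Set.Ioi u) := by
  have h1 : MeasureTheory.IntegrableOn (fun v => Real.exp (-δ * v)) (Set.Ioi u) :=
    integrableOn_exp_mul_Ioi (by linarith) u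
  refine MeasureTheory.Integrable.mono' (h1.mul_const M) ?_ ?_
  · exact (Continuous.aestronglyMeasurable (by fun_prop)).restrict
  · refine Eventually.of_forall fun v => ?_
    rw [norm_mul, Real.norm_eq_abs, Real.norm_eq_abs, abs_of_pos (Real.exp_pos _)]
    exact mul_le_mul_of_nonneg_left (hM v) (Real.exp_pos _).le

/-- The tail form shows boundedness, since `e^{δu}` is compensated by the decay of the tail; the
form in the definition is the one to differentiate. -/
lemma unstableSol_eq {δ M : ℝ} (hδ : 0 < δ) {g : ℝ → ℝ} (hg : Continuous g)
    (hM : ∀ u, |g u| ≤ M) (u : ℝ) :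
    unstableSol δ g u =
      -(Real.exp (δ * u) * ∫ v in Set.Ioi u, Real.exp (-δ * v) * g v) := by
  have h := intervalIntegral.integral_Ioi_sub_Ioi' (integrableOn_exp_mul hδ hg hM 0)
    (integrableOn_exp_mul hδ hg hM u)
  rw [unstableSol, ← h]
  ring

lemma abs_unstableSol_le {δ M : ℝ} (hδ : 0 < δ) {g : ℝ → ℝ} (hg : Continuous g)
    (hM : ∀ u, |g u| ≤ M) (u : ℝ) : |unstableSol δ g u| ≤ M / δ := by
  rw [unstableSol_eq hδ hg hM, abs_neg, abs_mul, abs_of_pos (Real.exp_pos _)]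
  have h1 : MeasureTheory.IntegrableOn (fun v => Real.exp (-δ * v)) (Set.Ioi u) :=
    integrableOn_exp_mul_Ioi (by linarith) u
  have h2 : |∫ v in Set.Ioi u, Real.exp (-δ * v) * g v| ≤
      ∫ v in Set.Ioi u, Real.exp (-δ * v) * M := by
    rw [← Real.norm_eq_abs]
    refine MeasureTheory.norm_integral_le_of_norm_le (h1.mul_const M)
      (Eventually.of_forall fun v => ?_)
    rw [norm_mul, Real.norm_eq_abs, Real.norm_eq_abs, abs_of_pos (Real.exp_pos _)]
    exact mul_le_mul_of_nonneg_left (hM v) (Real.exp_pos _).le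
  rw [MeasureTheory.integral_mul_const, integral_exp_mul_Ioi (by linarith)] at h2
  calc _ ≤ Real.exp (δ * u) * (-Real.exp (-δ * u) / -δ * M) :=
        mul_le_mul_of_nonneg_left h2 (Real.exp_pos _).le
    _ = Real.exp (δ * u) * Real.exp (-δ * u) * M / δ := by ring
    _ = M / δ := by rw [← Real.exp_add]; simp

lemma hasDerivAt_unstableSol {δ : ℝ} {g : ℝ → ℝ} (hg : Continuous g) (u : ℝ) :
    HasDerivAt (unstableSol δ g) (δ * unstableSol δ g u + g u) u := by
  have hc : Continuous fun v => Real.exp (-δ * v) * g v := by fun_prop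
  have h1 := (hc.integral_hasStrictDerivAt 0 u).hasDerivAt
  have h2 : HasDerivAt (fun u : ℝ => Real.exp (δ * u)) (Real.exp (δ * u) * δ) u := by
    simpa using ((hasDerivAt_id u).const_mul δ).exp
  refine (h2.mul (h1.sub_const
    (∫ v in Set.Ioi (0 : ℝ), Real.exp (-δ * v) * g v))).congr_deriv ?_
  rw [← mul_assoc (Real.exp (δ * u)) (Real.exp (-δ * u)), ← Real.exp_add]
  simp [unstableSol]
  ring

lemma hasDerivAt_stableSol {δ a : ℝ} {w : ℝ → ℝ} (hw : Continuous w) (u : ℝ) :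
    HasDerivAt (stableSol δ a w) (-δ * stableSol δ a w u + w u) u := by
  have hc : Continuous fun v => Real.exp (δ * v) * w v := by fun_prop
  have h1 := (hc.integral_hasStrictDerivAt 0 u).hasDerivAt
  have h2 : HasDerivAt (fun u : ℝ => Real.exp (-δ * u)) (Real.exp (-δ * u) * -δ) u := by
    simpa using ((hasDerivAt_id u).const_mul (-δ)).exp
  refine (h2.mul (h1.const_add a)).congr_deriv ?_
  rw [← mul_assoc (Real.exp (-δ * u)) (Real.exp (δ * u)), ← Real.exp_add]
  simp [stableSol]
  ring

lemma abs_stableSol_le {δ a M : ℝ} (hδ : 0 < δ) {w : ℝ → ℝ}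
    (hM : ∀ u, |w u| ≤ M) {u : ℝ} (hu : 0 ≤ u) : |stableSol δ a w u| ≤ |a| + M / δ := by
  have hM0 : 0 ≤ M := (abs_nonneg _).trans (hM 0)
  have h2 : |∫ v in (0 : ℝ)..u, Real.exp (δ * v) * w v| ≤
      ∫ v in (0 : ℝ)..u, Real.exp (δ * v) * M := by
    rw [← Real.norm_eq_abs]
    refine intervalIntegral.norm_integral_le_of_norm_le hu (Eventually.of_forall fun v _ => ?_)
      (Continuous.intervalIntegrable (by fun_prop) _ _)
    rw [norm_mul, Real.norm_eq_abs, Real.norm_eq_abs, abs_of_pos (Real.exp_pos _)]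
    exact mul_le_mul_of_nonneg_left (hM v) (Real.exp_pos _).le
  have h3 : ∫ v in (0 : ℝ)..u, Real.exp (δ * v) * M = (Real.exp (δ * u) - 1) / δ * M := by
    rw [intervalIntegral.integral_mul_const,
      intervalIntegral.integral_comp_mul_left (f := Real.exp) hδ.ne']
    simp [integral_exp, div_eq_inv_mul]
  rw [h3] at h2
  have he : Real.exp (-δ * u) ≤ 1 := Real.exp_le_one_iff.2 (by nlinarith)
  have he' : Real.exp (-δ * u) * Real.exp (δ * u) = 1 := by rw [← Real.exp_add]; simp
  have hpos := Real.exp_pos (-δ * u)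
  rw [stableSol, abs_mul, abs_of_pos hpos]
  calc _ ≤ Real.exp (-δ * u) * (|a| + (Real.exp (δ * u) - 1) / δ * M) :=
        mul_le_mul_of_nonneg_left ((abs_add_le _ _).trans (by linarith)) hpos.le
    _ = Real.exp (-δ * u) * |a| +
        (Real.exp (-δ * u) * Real.exp (δ * u) - Real.exp (-δ * u)) * (M / δ) := by ring
    _ ≤ |a| + M / δ := by
        rw [he']
        have h5 : 0 ≤ M / δ := by positivity
        nlinarith [abs_nonneg a]

lemma continuous_unstableSol {δ : ℝ} {g : ℝ → ℝ} (hg : Continuous g) :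
    Continuous (unstableSol δ g) :=
  continuous_iff_continuousAt.2 fun u => (hasDerivAt_unstableSol hg u).continuousAt

lemma continuous_stableSol {δ a : ℝ} {w : ℝ → ℝ} (hw : Continuous w) :
    Continuous (stableSol δ a w) :=
  continuous_iff_continuousAt.2 fun u => (hasDerivAt_stableSol hw u).continuousAt

lemma unstableSol_sub {δ M₁ M₂ : ℝ} (hδ : 0 < δ) {g₁ g₂ : ℝ → ℝ} (hg₁ : Continuous g₁)
    (hM₁ : ∀ u, |g₁ u| ≤ M₁) (hg₂ : Continuous g₂) (hM₂ : ∀ u, |g₂ u| ≤ M₂) :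
    unstableSol δ (fun v => g₁ v - g₂ v) =
      fun u => unstableSol δ g₁ u - unstableSol δ g₂ u := by
  funext u
  have h1 := integrableOn_exp_mul hδ hg₁ hM₁ 0
  have h2 := integrableOn_exp_mul hδ hg₂ hM₂ 0
  simp only [unstableSol, mul_sub]
  rw [MeasureTheory.integral_sub h1 h2, intervalIntegral.integral_sub
    (Continuous.intervalIntegrable (by fun_prop) _ _)
    (Continuous.intervalIntegrable (by fun_prop) _ _)]
  ring

lemma stableSol_sub (δ a : ℝ) {w₁ w₂ : ℝ → ℝ} (hw₁ : Continuous w₁) (hw₂ : Continuous w₂)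
    (u : ℝ) :
    stableSol δ 0 (fun v => w₁ v - w₂ v) u = stableSol δ a w₁ u - stableSol δ a w₂ u := by
  simp only [stableSol, mul_sub]
  rw [intervalIntegral.integral_sub
    (Continuous.intervalIntegrable (by fun_prop) _ _)
    (Continuous.intervalIntegrable (by fun_prop) _ _)]
  ring

/-- The bounded solution on `[0, ∞)` of `ψ'' = δ² ψ + g`, `ψ 0 = a`. -/
def dirichletSol (δ a : ℝ) (g : ℝ → ℝ) : ℝ → ℝ := stableSol δ a (unstableSol δ g)

lemma abs_dirichletSol_le {δ a M : ℝ} (hδ : 0 < δ) {g : ℝ → ℝ} (hg : Continuous g)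
    (hM : ∀ u, |g u| ≤ M) {u : ℝ} (hu : 0 ≤ u) :
    |dirichletSol δ a g u| ≤ |a| + M / δ ^ 2 := by
  have := abs_stableSol_le (a := a) hδ (abs_unstableSol_le hδ hg hM) hu
  rwa [div_div, ← sq] at this

lemma abs_dirichletSol_sub_le {δ a M M₁ M₂ : ℝ} (hδ : 0 < δ) {g₁ g₂ : ℝ → ℝ}
    (hg₁ : Continuous g₁) (hM₁ : ∀ u, |g₁ u| ≤ M₁) (hg₂ : Continuous g₂)
    (hM₂ : ∀ u, |g₂ u| ≤ M₂) (hM : ∀ u, |g₁ u - g₂ u| ≤ M) {u : ℝ} (hu : 0 ≤ u) :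
    |dirichletSol δ a g₁ u - dirichletSol δ a g₂ u| ≤ M / δ ^ 2 := by
  have h := abs_dirichletSol_le (a := 0) (g := fun v => g₁ v - g₂ v) hδ (hg₁.sub hg₂) hM hu
  rw [abs_zero, zero_add, dirichletSol, unstableSol_sub hδ hg₁ hM₁ hg₂ hM₂,
    stableSol_sub δ a (continuous_unstableSol hg₁) (continuous_unstableSol hg₂)] at h
  exact h

lemma dirichletSol_zero (δ a : ℝ) (g : ℝ → ℝ) : dirichletSol δ a g 0 = a := by
  simp [dirichletSol, stableSol]

/-- A semilinear system `ψ'' = δ² ψ + g(u, ψ)` with a nonlinearity of small Lipschitz constant has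
a bounded solution on `[0, ∞)` with prescribed initial position. -/
theorem exists_bounded_solution {ι : Type*} [Fintype ι] (δ : ι → ℝ) (hδ : ∀ i, 0 < δ i)
    {κ ε β : ℝ} (hκ0 : 0 ≤ κ) (hκ : ∀ i, 1 / δ i ^ 2 ≤ κ) (hε : 0 ≤ ε) (hκε : κ * ε ≤ 1 / 2)
    (g : ℝ → (ι → ℝ) → ι → ℝ)
    (hg : Continuous fun p : ℝ × (ι → ℝ) => g p.1 p.2)
    (hlip : ∀ u x y, ‖g u x - g u y‖ ≤ ε * ‖x - y‖) (hβ : ∀ u, ‖g u 0‖ ≤ β) (a : ι → ℝ) :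
    ∃ ψ ψ' : ℝ → ι → ℝ, ψ 0 = a ∧ (∀ u, 0 ≤ u → ‖ψ u‖ ≤ 2 * (‖a‖ + κ * β)) ∧
      (∃ C, ∀ u, 0 ≤ u → ‖ψ' u‖ ≤ C) ∧ ∀ u, 0 ≤ u → HasDerivAt ψ (ψ' u) u ∧
        HasDerivAt ψ' (fun i => δ i ^ 2 * ψ u i + g u (ψ u) i) u := by
  have hβ0 : 0 ≤ β := (norm_nonneg _).trans (hβ 0)
  have hbd : ∀ u x, ‖g u x‖ ≤ β + ε * ‖x‖ := fun u x => by
    have h1 := hlip u x 0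
    rw [sub_zero] at h1
    have h2 := norm_sub_norm_le (g u x) (g u 0)
    linarith [hβ u]
  have hcont : ∀ (φ : BoundedContinuousFunction ℝ (ι → ℝ)) (i : ι),
      Continuous fun v => g v (φ v) i := fun φ i =>
    (continuous_apply i).comp (hg.comp (continuous_id.prodMk φ.continuous))
  have hgb : ∀ (φ : BoundedContinuousFunction ℝ (ι → ℝ)) (i : ι) (u : ℝ),
      |g u (φ u) i| ≤ β + ε * ‖φ‖ := fun φ i u =>
    (norm_le_pi_norm (g u (φ u)) i).trans ((hbd u _).trans
      (by gcongr; exact φ.norm_coe_le_norm u))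
  have hdiv : ∀ (M : ℝ) (i : ι), 0 ≤ M → M / δ i ^ 2 ≤ κ * M := fun M i hM => by
    rw [div_eq_mul_one_div, mul_comm]
    exact mul_le_mul_of_nonneg_right (hκ i) hM
  let S : BoundedContinuousFunction ℝ (ι → ℝ) → ℝ → ι → ℝ :=
    fun φ u i => dirichletSol (δ i) (a i) (fun v => g v (φ v) i) u
  have hSc : ∀ φ, Continuous (S φ) := fun φ => continuous_pi fun i =>
    continuous_stableSol (continuous_unstableSol (hcont φ i))
  have hSb : ∀ φ u, 0 ≤ u → ‖S φ u‖ ≤ ‖a‖ + κ * (β + ε * ‖φ‖) := fun φ u hu => by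
    refine (pi_norm_le_iff_of_nonneg (by positivity)).2 fun i => ?_
    exact (abs_dirichletSol_le (hδ i) (hcont φ i) (hgb φ i) hu).trans
      (add_le_add (norm_le_pi_norm a i) (hdiv _ i (by positivity)))
  -- The bounds on `S φ` hold only for `u ≥ 0`; freezing the argument at `max u 0` gives a bounded
  -- function on the whole line without changing the half-line.
  let T : BoundedContinuousFunction ℝ (ι → ℝ) → BoundedContinuousFunction ℝ (ι → ℝ) := fun φ =>
    BoundedContinuousFunction.ofNormedAddCommGroup (fun u => S φ (max u 0))
      ((hSc φ).comp (by fun_prop)) (‖a‖ + κ * (β + ε * ‖φ‖))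
      fun u => hSb φ _ (le_max_right _ _)
  have hT : ContractingWith (1 / 2) T := by
    refine ⟨by rw [← NNReal.coe_lt_coe]; norm_num, LipschitzWith.of_dist_le_mul fun φ₁ φ₂ => ?_⟩
    rw [BoundedContinuousFunction.dist_le (by positivity)]
    intro u
    rw [dist_eq_norm]
    refine (pi_norm_le_iff_of_nonneg (by positivity)).2 fun i => ?_
    have h1 : ∀ v, |g v (φ₁ v) i - g v (φ₂ v) i| ≤ ε * dist φ₁ φ₂ := fun v =>
      (norm_le_pi_norm (g v (φ₁ v) - g v (φ₂ v)) i).trans ((hlip v _ _).trans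
        (by gcongr; rw [← dist_eq_norm]; exact BoundedContinuousFunction.dist_coe_le_dist v))
    have h2 := abs_dirichletSol_sub_le (a := a i) (hδ i) (hcont φ₁ i) (hgb φ₁ i) (hcont φ₂ i)
      (hgb φ₂ i) h1 (le_max_right u 0)
    refine h2.trans ((hdiv _ i (by positivity)).trans ?_)
    rw [← mul_assoc]
    refine mul_le_mul_of_nonneg_right (hκε.trans ?_) dist_nonneg
    norm_num
  obtain ⟨φ, hφ⟩ : ∃ φ, T φ = φ := ⟨_, hT.fixedPoint_isFixedPt⟩
  have hval : ∀ u, 0 ≤ u → S φ u = φ u := fun u hu => by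
    conv_rhs => rw [← hφ]
    change S φ u = S φ (max u 0)
    rw [max_eq_left hu]
  -- Since `κ * ε ≤ 1/2`, the term in `‖φ‖` on the right is absorbed, at the cost of the factor 2.
  have hφn : ‖φ‖ ≤ 2 * (‖a‖ + κ * β) := by
    have : ‖φ‖ ≤ ‖a‖ + κ * (β + ε * ‖φ‖) := by
      conv_lhs => rw [← hφ]
      exact BoundedContinuousFunction.norm_ofNormedAddCommGroup_le _ (by positivity) _
    nlinarith [norm_nonneg φ]
  -- The second-order operator factors as `(d/du - δ)(d/du + δ)`, so `ψ' = -δ ψ + w` with `w' = δ w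
  -- + g`.
  refine ⟨S φ, fun u i => -δ i * S φ u i + unstableSol (δ i) (fun v => g v (φ v) i) u,
    funext fun i => dirichletSol_zero _ _ _, fun u hu => ?_, ?_, fun u hu => ⟨?_, ?_⟩⟩
  · rw [hval u hu]
    exact (φ.norm_coe_le_norm u).trans hφn
  · refine ⟨‖δ‖ * ‖φ‖ + ∑ i, (β + ε * ‖φ‖) / δ i, fun u hu => ?_⟩
    have hnn : ∀ i, 0 ≤ (β + ε * ‖φ‖) / δ i := fun i => by have := hδ i; positivity
    refine (pi_norm_le_iff_of_nonneg
      (add_nonneg (by positivity) (Finset.sum_nonneg fun i _ => hnn i))).2 fun i => ?_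
    refine (norm_add_le _ _).trans (add_le_add ?_ ?_)
    · rw [norm_mul, norm_neg, hval u hu]
      exact mul_le_mul (norm_le_pi_norm δ i)
        ((norm_le_pi_norm (φ u) i).trans (φ.norm_coe_le_norm u)) (norm_nonneg _) (norm_nonneg _)
    · exact (abs_unstableSol_le (hδ i) (hcont φ i) (hgb φ i) u).trans
        (Finset.single_le_sum (fun i _ => hnn i) (Finset.mem_univ i))
  · exact hasDerivAt_pi.2 fun i => hasDerivAt_stableSol (continuous_unstableSol (hcont φ i)) u
  · refine hasDerivAt_pi.2 fun i => ?_
    have h1 := hasDerivAt_stableSol (δ := δ i) (a := a i)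
      (continuous_unstableSol (δ := δ i) (hcont φ i)) u
    have h2 := hasDerivAt_unstableSol (δ := δ i) (hcont φ i) u
    refine ((h1.const_mul (-δ i)).add h2).congr_deriv ?_
    rw [← hval u hu]
    simp only [S, dirichletSol]
    ring

/-! ### The mass scalar product -/

/-- The mass scalar product as a continuous bilinear form. -/
def massForm (m : Fin H → ℝ) : Configuration H k →L[ℝ] Configuration H k →L[ℝ] ℝ :=
  ∑ j, m j • (innerSL ℝ).bilinearComp (ContinuousLinearMap.proj (R := ℝ) j)
    (ContinuousLinearMap.proj (R := ℝ) j)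

@[simp] lemma massForm_apply (m : Fin H → ℝ) (x y : Configuration H k) :
    massForm m x y = massInner m x y := by
  simp [massForm, massInner]

lemma massInner_comm (m : Fin H → ℝ) (x y : Configuration H k) :
    massInner m x y = massInner m y x := by
  simp only [massInner, real_inner_comm]

lemma massInner_self_nonneg {m : Fin H → ℝ} (hm : ∀ j, 0 < m j) (x : Configuration H k) :
    0 ≤ massInner m x x :=
  Finset.sum_nonneg fun j _ => mul_nonneg (hm j).le real_inner_self_nonneg

lemma massInner_self_eq_zero {m : Fin H → ℝ} (hm : ∀ j, 0 < m j) {x : Configuration H k}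
    (h : massInner m x x = 0) : x = 0 := by
  funext j
  have h1 := (Finset.sum_eq_zero_iff_of_nonneg
    fun j _ => mul_nonneg (hm j).le real_inner_self_nonneg).1 h j (Finset.mem_univ j)
  exact inner_self_eq_zero.1 ((mul_eq_zero.1 h1).resolve_left (hm j).ne')

lemma massNorm_sq {m : Fin H → ℝ} (hm : ∀ j, 0 < m j) (x : Configuration H k) :
    massNorm m x ^ 2 = massInner m x x :=
  Real.sq_sqrt (massInner_self_nonneg hm x)

lemma massInner_smul_left (m : Fin H → ℝ) (s : ℝ) (x y : Configuration H k) :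
    massInner m (s • x) y = s * massInner m x y := by
  simp [← massForm_apply]

lemma massInner_smul_right (m : Fin H → ℝ) (s : ℝ) (x y : Configuration H k) :
    massInner m x (s • y) = s * massInner m x y := by
  simp [← massForm_apply]

lemma massNorm_smul (m : Fin H → ℝ) {s : ℝ} (hs : 0 ≤ s) (x : Configuration H k) :
    massNorm m (s • x) = s * massNorm m x := by
  rw [massNorm, massInner_smul_left, massInner_smul_right, ← mul_assoc, Real.sqrt_mul
    (mul_self_nonneg s), Real.sqrt_mul_self hs, massNorm]

lemma continuous_massNorm (m : Fin H → ℝ) : Continuous (massNorm m : Configuration H k → ℝ) := by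
  unfold massNorm massInner
  fun_prop

lemma hasFDerivAt_massNorm {m : Fin H → ℝ} {x : Configuration H k} (hx : massNorm m x ≠ 0) :
    HasFDerivAt (massNorm m) ((massNorm m x)⁻¹ • massForm m x) x := by
  have h1 : HasFDerivAt (fun y : Configuration H k => massForm m y y)
      ((2 : ℝ) • massForm m x) x := by
    refine ((massForm m).hasFDerivAt.clm_apply (hasFDerivAt_id x)).congr_fderiv ?_
    ext v
    simp [massInner_comm m v x]
    ring
  have h2 : massForm m x x ≠ 0 := fun h => hx (by
    rw [massForm_apply] at h; rw [massNorm, h, Real.sqrt_zero])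
  have h3 := h1.sqrt h2
  simp only [massForm_apply] at h3
  refine h3.congr_fderiv ?_
  rw [smul_smul]
  congr 1
  simp only [massNorm]
  field_simp

/-! ### The acceleration field: homogeneity and smoothness -/

/-- The accelerations of the bodies in configuration `p.1` with the primaries at `p.2`. -/
def acceleration (mt : Fin N → ℝ) (m : Fin H → ℝ)
    (p : Configuration H k × (Fin N → EuclideanSpace ℝ (Fin k))) : Configuration H k :=
  fun j => (m j)⁻¹ • force mt m p.2 p.1 j

lemma acceleration_smul (mt : Fin N → ℝ) (m : Fin H → ℝ) {s : ℝ} (hs : 0 < s)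
    (p : Configuration H k × (Fin N → EuclideanSpace ℝ (Fin k))) :
    acceleration mt m (s • p) = (s ^ 2)⁻¹ • acceleration mt m p := by
  have key : ∀ (M : ℝ) (x y : EuclideanSpace ℝ (Fin k)),
      (M / ‖s • x - s • y‖ ^ 3) • (s • x - s • y) =
        (s ^ 2)⁻¹ • ((M / ‖x - y‖ ^ 3) • (x - y)) := fun M x y => by
    rw [← smul_sub, norm_smul, Real.norm_of_nonneg hs.le, smul_smul, smul_smul]
    congr 1
    -- At a collision both sides vanish because division by zero gives zero, so no collision
    -- hypothesis is needed.
    rcases eq_or_ne (‖x - y‖) 0 with h | h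
    · simp [h]
    · field_simp
  funext j
  simp only [acceleration, force, Prod.smul_fst, Prod.smul_snd, Pi.smul_apply, key,
    ← Finset.smul_sum]
  rw [← smul_neg, ← smul_sub, smul_comm]

/-- No collisions, neither among the bodies nor with the primaries. -/
def collisionFree (N H k : ℕ) : Set (Configuration H k × (Fin N → EuclideanSpace ℝ (Fin k))) :=
  {p | (∀ l j, l ≠ j → p.1 l ≠ p.1 j) ∧ ∀ i j, p.1 j ≠ p.2 i}

lemma isOpen_collisionFree : IsOpen (collisionFree N H k) := by
  simp only [collisionFree, Set.ofPred_and, Set.ofPred_forall]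
  refine IsOpen.inter ?_ ?_
  · exact isOpen_iInter_of_finite fun l => isOpen_iInter_of_finite fun j =>
      isOpen_iInter_of_finite fun _ => isOpen_ne_fun (by fun_prop) (by fun_prop)
  · exact isOpen_iInter_of_finite fun l => isOpen_iInter_of_finite fun j =>
      isOpen_ne_fun (by fun_prop) (by fun_prop)

lemma isOpen_domain : IsOpen (domain H k) := by
  simp only [domain, Set.ofPred_and, Set.ofPred_forall]
  refine IsOpen.inter ?_ ?_
  · exact isOpen_iInter_of_finite fun j => isOpen_ne_fun (by fun_prop) (by fun_prop)
  · exact isOpen_iInter_of_finite fun l => isOpen_iInter_of_finite fun j =>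
      isOpen_iInter_of_finite fun _ => isOpen_ne_fun (by fun_prop) (by fun_prop)

lemma smul_mem_domain {x : Configuration H k} (hx : x ∈ domain H k) {s : ℝ} (hs : s ≠ 0) :
    s • x ∈ domain H k :=
  ⟨fun j => smul_ne_zero hs (hx.1 j), fun l j hlj h => hx.2 l j hlj (smul_right_injective _ hs h)⟩

lemma smul_mem_collisionFree {p : Configuration H k × (Fin N → EuclideanSpace ℝ (Fin k))}
    (hp : p ∈ collisionFree N H k) {s : ℝ} (hs : s ≠ 0) : s • p ∈ collisionFree N H k :=
  ⟨fun l j hlj h => hp.1 l j hlj (smul_right_injective _ hs h),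
    fun i j h => hp.2 i j (smul_right_injective _ hs h)⟩

lemma mem_collisionFree_of_mem_domain {x : Configuration H k} (hx : x ∈ domain H k) :
    (x, (0 : Fin N → EuclideanSpace ℝ (Fin k))) ∈ collisionFree N H k :=
  ⟨hx.2, fun _ j => hx.1 j⟩

lemma contDiffAt_acceleration (mt : Fin N → ℝ) (m : Fin H → ℝ)
    {p : Configuration H k × (Fin N → EuclideanSpace ℝ (Fin k))} (hp : p ∈ collisionFree N H k) :
    ContDiffAt ℝ 1 (acceleration mt m) p := by
  refine contDiffAt_pi.2 fun j => ?_
  have key : ∀ (M : ℝ) (f : Configuration H k × (Fin N → EuclideanSpace ℝ (Fin k)) →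
      EuclideanSpace ℝ (Fin k)), ContDiffAt ℝ 1 f p → f p ≠ 0 →
      ContDiffAt ℝ 1 (fun p => (M / ‖f p‖ ^ 3) • f p) p := fun M f hf hne =>
    by
    have h1 : ContDiffAt ℝ 1 (fun p => M / ‖f p‖ ^ 3) p :=
      contDiffAt_const.div ((hf.norm ℝ hne).pow 3) (pow_ne_zero 3 (norm_ne_zero_iff.2 hne))
    exact h1.smul hf
  simp only [acceleration, force]
  refine ContDiffAt.const_smul _ (ContDiffAt.sub (ContDiffAt.neg ?_) ?_)
  · refine ContDiffAt.sum fun i _ => ?_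
    exact key _ (fun p => p.1 j - p.2 i) (by fun_prop) (sub_ne_zero.2 (hp.2 i j))
  · refine ContDiffAt.sum fun l hl => ?_
    exact key _ (fun p => p.1 j - p.1 l) (by fun_prop)
      (sub_ne_zero.2 (hp.1 j l (Finset.ne_of_mem_erase hl).symm))

/-! ### The acceleration as mass gradient of the potential -/

lemma hasFDerivAt_inv_norm {E : Type*} [NormedAddCommGroup E] [InnerProductSpace ℝ E] {q : E}
    (hq : q ≠ 0) :
    HasFDerivAt (fun q : E => ‖q‖⁻¹) (-(‖q‖ ^ 3)⁻¹ • innerSL ℝ q) q := by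
  have h0 : ‖q‖ ≠ 0 := norm_ne_zero_iff.2 hq
  have h1 : HasFDerivAt (fun q : E => √(‖q‖ ^ 2)) _ q :=
    (hasStrictFDerivAt_norm_sq q).hasFDerivAt.sqrt (pow_ne_zero 2 h0)
  simp only [Real.sqrt_sq (norm_nonneg _)] at h1
  refine ((hasDerivAt_inv h0).comp_hasFDerivAt q h1).congr_fderiv ?_
  ext v
  simp
  field_simp

/-- Passes from the unordered pairs of the potential to the ordered pairs of the forces. -/
lemma sum_sum_Iio_add_swap (f : Fin H → Fin H → ℝ) :
    ∑ j, ∑ l ∈ Finset.Iio j, (f l j + f j l) = ∑ j, ∑ l ∈ Finset.univ.erase j, f l j := by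
  have h1 : ∀ j : Fin H, ∑ l ∈ Finset.univ.erase j, f l j =
      ∑ l ∈ Finset.Iio j, f l j + ∑ l ∈ Finset.Ioi j, f l j := fun j => by
    rw [← Finset.sum_union]
    · refine Finset.sum_congr ?_ fun _ _ => rfl
      ext l
      simp [lt_or_lt_iff_ne]
    · exact Finset.disjoint_left.2 fun l hl hl' =>
        lt_asymm (Finset.mem_Iio.1 hl) (Finset.mem_Ioi.1 hl')
  simp only [h1, Finset.sum_add_distrib]
  congr 1
  exact Finset.sum_comm' (by simp)

/-- The right-hand side is the derivative of `U` at `x` along `v`, expanded term by term; pairwise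
forces combine by action and reaction. -/
lemma massInner_acceleration {mt : Fin N → ℝ} {m : Fin H → ℝ} (hm : ∀ j, 0 < m j)
    (x v : Configuration H k) :
    massInner m (acceleration mt m (x, 0)) v =
      (∑ i, mt i) * ∑ j, m j * -((‖x j‖ ^ 3)⁻¹ * inner ℝ (x j) (v j)) +
        ∑ j, ∑ l ∈ Finset.Iio j,
          m l * m j * -((‖x l - x j‖ ^ 3)⁻¹ * inner ℝ (x l - x j) (v l - v j)) := by
  have h1 : ∀ j l : Fin H,
      m l * m j * -((‖x l - x j‖ ^ 3)⁻¹ * inner ℝ (x l - x j) (v l - v j)) =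
        m l * m j * (‖x j - x l‖ ^ 3)⁻¹ * -inner ℝ (x j - x l) (v j) +
        m j * m l * (‖x l - x j‖ ^ 3)⁻¹ * -inner ℝ (x l - x j) (v l) := fun j l => by
    rw [norm_sub_rev (x j) (x l), ← neg_sub (x l) (x j), inner_neg_left, inner_sub_right]
    ring
  simp only [h1]
  rw [sum_sum_Iio_add_swap
    (fun l j => m l * m j * (‖x j - x l‖ ^ 3)⁻¹ * -inner ℝ (x j - x l) (v j)), Finset.mul_sum,
    ← Finset.sum_add_distrib]
  refine Finset.sum_congr rfl fun j _ => ?_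
  simp only [acceleration, force, Pi.zero_apply, sub_zero, inner_smul_left, inner_sub_left,
    inner_neg_left, ← Finset.sum_smul, sum_inner, ← Finset.sum_div, ← Finset.sum_mul,
    RCLike.conj_to_real]
  rw [← mul_assoc, mul_inv_cancel₀ (hm j).ne', one_mul, sub_eq_add_neg, ← Finset.sum_neg_distrib]
  congr 1
  · ring
  · refine Finset.sum_congr rfl fun l _ => ?_
    ring

lemma hasFDerivAt_potential (mt : Fin N → ℝ) {m : Fin H → ℝ} (hm : ∀ j, 0 < m j)
    {x : Configuration H k} (hx : x ∈ domain H k) :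
    HasFDerivAt (potential mt m) (massForm m (acceleration mt m (x, 0))) x := by
  have h1 : ∀ j, HasFDerivAt (fun y : Configuration H k => ‖y j‖⁻¹) _ x := fun j =>
    HasFDerivAt.comp (g := fun q : EuclideanSpace ℝ (Fin k) => ‖q‖⁻¹) x
      (hasFDerivAt_inv_norm (hx.1 j))
      (ContinuousLinearMap.proj (R := ℝ) (φ := fun _ : Fin H => EuclideanSpace ℝ (Fin k))
        j).hasFDerivAt
  have h2 : ∀ j, ∀ l ∈ Finset.Iio j,
      HasFDerivAt (fun y : Configuration H k => ‖y l - y j‖⁻¹) _ x := fun j l hl =>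
    HasFDerivAt.comp (g := fun q : EuclideanSpace ℝ (Fin k) => ‖q‖⁻¹) x
      (hasFDerivAt_inv_norm (q := x l - x j) (sub_ne_zero.2 (hx.2 l j (Finset.mem_Iio.1 hl).ne)))
      ((ContinuousLinearMap.proj (R := ℝ) (φ := fun _ : Fin H => EuclideanSpace ℝ (Fin k)) l) -
        (ContinuousLinearMap.proj (R := ℝ) (φ := fun _ : Fin H => EuclideanSpace ℝ (Fin k))
        j)).hasFDerivAt
  have h3 := ((HasFDerivAt.fun_sum fun j (_ : j ∈ Finset.univ) =>
    (h1 j).const_mul (m j)).const_mul (∑ i, mt i)).add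
    (HasFDerivAt.fun_sum fun j (_ : j ∈ Finset.univ) =>
      HasFDerivAt.fun_sum fun l hl => (h2 j l hl).const_mul (m l * m j))
  refine h3.congr_fderiv ?_
  ext v
  rw [massForm_apply, massInner_acceleration hm]
  simp only [add_apply, smul_apply, sum_apply, ContinuousLinearMap.comp_apply, sub_apply,
    ContinuousLinearMap.proj_apply, innerSL_apply_apply, smul_eq_mul, neg_mul]

lemma potential_smul (mt : Fin N → ℝ) (m : Fin H → ℝ) {s : ℝ} (hs : 0 < s)
    (x : Configuration H k) : potential mt m (s • x) = s⁻¹ * potential mt m x := by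
  have key : ∀ (M : ℝ) (y : EuclideanSpace ℝ (Fin k)), M / ‖s • y‖ = s⁻¹ * (M / ‖y‖) :=
    fun M y => by
      rw [norm_smul, Real.norm_of_nonneg hs.le, div_mul_eq_div_div_swap]
      ring
  simp only [potential, Pi.smul_apply, ← smul_sub, key, ← Finset.mul_sum]
  ring

lemma potential_pos {mt : Fin N → ℝ} (hN : 0 < N) (hH : 0 < H) (hmt : ∀ i, 0 < mt i)
    {m : Fin H → ℝ} (hm : ∀ j, 0 < m j) {x : Configuration H k} (hx : x ∈ domain H k) :
    0 < potential mt m x := by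
  have : Nonempty (Fin N) := ⟨⟨0, hN⟩⟩
  have : Nonempty (Fin H) := ⟨⟨0, hH⟩⟩
  refine add_pos_of_pos_of_nonneg (mul_pos (Finset.sum_pos (fun i _ => hmt i)
    Finset.univ_nonempty) (Finset.sum_pos (fun j _ => div_pos (hm j) (norm_pos_iff.2 (hx.1 j)))
    Finset.univ_nonempty)) (Finset.sum_nonneg fun j _ => Finset.sum_nonneg fun l _ => ?_)
  exact div_nonneg (mul_pos (hm l) (hm j)).le (norm_nonneg _)

/-- Euler's identity for the potential, homogeneous of degree -1. -/
lemma massInner_acceleration_self (mt : Fin N → ℝ) {m : Fin H → ℝ} (hm : ∀ j, 0 < m j)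
    {x : Configuration H k} (hx : x ∈ domain H k) :
    massInner m (acceleration mt m (x, 0)) x = -potential mt m x := by
  have h0 : HasDerivAt (fun s : ℝ => s • x) x 1 := by
    simpa using (hasDerivAt_id (1 : ℝ)).smul_const x
  have h1 : HasDerivAt (fun s : ℝ => potential mt m (s • x))
      (massForm m (acceleration mt m (x, 0)) x) 1 :=
    HasFDerivAt.comp_hasDerivAt (l := potential mt m) (f := fun s : ℝ => s • x) (1 : ℝ) (by simpa using hasFDerivAt_potential mt hm hx) h0
  have h2 : HasDerivAt (fun s : ℝ => s⁻¹ * potential mt m x) (-1 * potential mt m x) 1 := by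
    simpa using (hasDerivAt_inv (one_ne_zero (α := ℝ))).mul_const (potential mt m x)
  have h3 : (fun s : ℝ => potential mt m (s • x)) =ᶠ[𝓝 1] fun s : ℝ => s⁻¹ * potential mt m x :=
    (lt_mem_nhds one_pos).mono fun s hs => potential_smul mt m hs x
  have := (h1.congr_of_eventuallyEq h3.symm).unique h2
  simpa using this

/-- By Euler's identity `a + U(ξ) ξ` is tangent at `ξ`; by criticality it is orthogonal to all
tangent vectors, hence to itself. -/
lemma acceleration_centralConfiguration {mt : Fin N → ℝ} {m : Fin H → ℝ} (hm : ∀ j, 0 < m j)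
    {ξ : Configuration H k} (hξ : IsCentralConfiguration mt m ξ) :
    acceleration mt m (ξ, 0) = -potential mt m ξ • ξ := by
  obtain ⟨hd, hn, hcrit⟩ := hξ
  have hξξ : massInner m ξ ξ = 1 := by rw [← massNorm_sq hm, hn, one_pow]
  set a := acceleration mt m (ξ, 0) with ha
  have h1 : ∀ v, massInner m ξ v = 0 → massInner m a v = 0 := fun v hv => by
    have := hcrit v hv
    rwa [(hasFDerivAt_potential mt hm hd).fderiv, massForm_apply] at this
  have h2 := massInner_acceleration_self mt hm hd
  have h3 : massInner m ξ (a + potential mt m ξ • ξ) = 0 := by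
    rw [← massForm_apply, map_add, map_smul, massForm_apply, massForm_apply, hξξ,
      massInner_comm, h2]
    simp
  have h4 : massInner m (a + potential mt m ξ • ξ) (a + potential mt m ξ • ξ) = 0 := by
    conv_lhs => rw [← massForm_apply, map_add, map_smul, massForm_apply, massForm_apply]
    rw [massInner_comm m _ a, massInner_comm m _ ξ, h1 _ h3, h3]
    simp
  rw [neg_smul]
  exact eq_neg_of_add_eq_zero_left (massInner_self_eq_zero hm h4)

/-! ### Linearization at the central configuration and the (BS) condition -/

/-- The linearization of the homogeneous acceleration field at `ξ`. -/
lemma hasFDerivAt_acceleration_zero {mt : Fin N → ℝ} {m : Fin H → ℝ} {ξ : Configuration H k}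
    {F' : Configuration H k × (Fin N → EuclideanSpace ℝ (Fin k)) →L[ℝ] Configuration H k}
    (hF : HasFDerivAt (acceleration mt m) F' (ξ, 0)) :
    HasFDerivAt (fun x => acceleration mt m (x, 0))
      (F'.comp (ContinuousLinearMap.inl ℝ _ _)) ξ :=
  HasFDerivAt.comp (g := acceleration mt m) ξ hF
    (hasFDerivAt_prodMk_left ξ (0 : Fin N → EuclideanSpace ℝ (Fin k)))

section Linearization

variable {mt : Fin N → ℝ} {m : Fin H → ℝ} {ξ : Configuration H k}
  {A : Configuration H k →L[ℝ] Configuration H k}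

/-- Euler's identity for the acceleration, homogeneous of degree -2. -/
lemma linearization_apply_self
    (hA : HasFDerivAt (fun x => acceleration mt m (x, 0)) A ξ) :
    A ξ = (-2 : ℝ) • acceleration mt m (ξ, 0) := by
  have h0 : HasDerivAt (fun s : ℝ => s • ξ) ξ 1 := by
    simpa using (hasDerivAt_id (1 : ℝ)).smul_const ξ
  have h1 : HasDerivAt (fun s : ℝ => acceleration mt m (s • ξ, 0)) (A ξ) 1 :=
    HasFDerivAt.comp_hasDerivAt (l := fun x => acceleration mt m (x, 0)) (1 : ℝ)
      (f := fun s : ℝ => s • ξ) (by simpa only [one_smul] using hA) h0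
  have h2 : HasDerivAt (fun s : ℝ => (s ^ 2)⁻¹ • acceleration mt m (ξ, 0))
      ((-2 : ℝ) • acceleration mt m (ξ, 0)) 1 := by
    have := ((hasDerivAt_pow 2 (1 : ℝ)).fun_inv (by norm_num)).smul_const
      (acceleration mt m (ξ, 0))
    simpa using this
  have h3 : (fun s : ℝ => acceleration mt m (s • ξ, 0)) =ᶠ[𝓝 1]
      fun s : ℝ => (s ^ 2)⁻¹ • acceleration mt m (ξ, 0) :=
    (lt_mem_nhds one_pos).mono fun s hs => by
      have := acceleration_smul mt m hs (ξ, 0)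
      simpa using this
  exact (h1.congr_of_eventuallyEq h3.symm).unique h2

/-- `A` represents the second derivative of `U` in the mass product. -/
lemma linearization_symmetric (hm : ∀ j, 0 < m j) (hd : ξ ∈ domain H k)
    (hA : HasFDerivAt (fun x => acceleration mt m (x, 0)) A ξ) (v w : Configuration H k) :
    massInner m (A v) w = massInner m v (A w) := by
  have h1 : ∀ᶠ y in 𝓝 ξ, HasFDerivAt (potential mt m)
      (massForm m (acceleration mt m (y, 0))) y :=
    Filter.Eventually.mono (isOpen_domain.mem_nhds hd) fun y hy => hasFDerivAt_potential mt hm hy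
  have h2 : HasFDerivAt (fun y => massForm m (acceleration mt m (y, 0)))
      ((massForm m).comp A) ξ := (massForm m).hasFDerivAt.comp ξ hA
  have h3 := second_derivative_symmetric_of_eventually h1 h2 v w
  simpa [massInner_comm m v] using h3

/-- By homogeneity the radial extension is `|y| U(y)` near `ξ`. Differentiating twice, every other
term carries a factor `⟨ξ, v⟩` or `⟨ξ, w⟩`. -/
lemma hessianRestricted_eq (hm : ∀ j, 0 < m j) (hd : ξ ∈ domain H k) (hn : massNorm m ξ = 1)
    (hA : HasFDerivAt (fun x => acceleration mt m (x, 0)) A ξ) {v w : Configuration H k}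
    (hv : massInner m ξ v = 0) (hw : massInner m ξ w = 0) :
    hessianRestricted mt m ξ v w =
      massInner m (A v) w + potential mt m ξ * massInner m v w := by
  have hnb : ∀ᶠ y in 𝓝 ξ, y ∈ domain H k ∧ 0 < massNorm m y :=
    Filter.Eventually.and (isOpen_domain.mem_nhds hd)
      ((continuous_massNorm m).continuousAt.eventually (lt_mem_nhds (by rw [hn]; exact one_pos)))
  have hext : ∀ y : Configuration H k, 0 < massNorm m y →
      radialExtension mt m y = massNorm m y * potential mt m y := fun y hy => by
    rw [radialExtension, potential_smul mt m (inv_pos.2 hy), inv_inv]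
  have h1 : ∀ᶠ y in 𝓝 ξ, fderiv ℝ (radialExtension mt m) y =
      massNorm m y • massForm m (acceleration mt m (y, 0)) +
        potential mt m y • ((massNorm m y)⁻¹ • massForm m y) := by
    filter_upwards [hnb.eventually_nhds] with y hy
    have hy0 := hy.self_of_nhds
    have h2 := ((hasFDerivAt_massNorm hy0.2.ne').mul (hasFDerivAt_potential mt hm hy0.1))
    exact (h2.congr_of_eventuallyEq (hy.mono fun z hz => hext z hz.2)).fderiv
  have hN := hasFDerivAt_massNorm (m := m) (x := ξ) (by rw [hn]; exact one_ne_zero)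
  have hN' := (hasDerivAt_inv (x := massNorm m ξ)
    (by rw [hn]; exact one_ne_zero)).comp_hasFDerivAt ξ hN
  have h3 := (hN.fun_smul ((massForm m).hasFDerivAt.comp ξ hA)).fun_add
    ((hasFDerivAt_potential mt hm hd).fun_smul
      (hN'.fun_smul (massForm m).hasFDerivAt))
  rw [hessianRestricted, (h3.congr_of_eventuallyEq h1).fderiv]
  simp [hn, hv, hw]

end Linearization

/-- Spectral theorem for an operator that is symmetric for a given scalar product. -/
lemma exists_eigenbasis {V : Type*} [AddCommGroup V] [Module ℝ V] [FiniteDimensional ℝ V]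
    (cd : InnerProductSpace.Core ℝ V) (A : V →ₗ[ℝ] V)
    (hA : ∀ v w, cd.inner (A v) w = cd.inner v (A w)) :
    ∃ (b : Module.Basis (Fin (Module.finrank ℝ V)) ℝ V) (μ : Fin (Module.finrank ℝ V) → ℝ),
      ∀ i, A (b i) = μ i • b i := by
  let _ : NormedAddCommGroup V := cd.toNormedAddCommGroup
  let _ : InnerProductSpace ℝ V := InnerProductSpace.ofCore cd.toCore
  have hS : A.IsSymmetric := hA
  refine ⟨(hS.eigenvectorBasis rfl).toBasis, hS.eigenvalues rfl, fun i => ?_⟩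
  rw [OrthonormalBasis.coe_toBasis]
  exact hS.apply_eigenvectorBasis rfl i

/-- The mass scalar product as the core of an inner product space. -/
@[reducible] def massCore {m : Fin H → ℝ} (hm : ∀ j, 0 < m j) :
    InnerProductSpace.Core ℝ (Configuration H k) where
  inner := massInner m
  conj_inner_symm x y := massInner_comm m y x
  re_inner_nonneg x := massInner_self_nonneg hm x
  add_left x y z := by simp [← massForm_apply]
  smul_left x y r := massInner_smul_left m r x y
  definite _ h := massInner_self_eq_zero hm h

/-- Under the Barutello–Secchi condition the linearized field has no eigenvalue below
`-9/8 U(ξ)`. -/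
lemma eigenvalue_linearization_gt {mt : Fin N → ℝ} {m : Fin H → ℝ} (hm : ∀ j, 0 < m j)
    {ξ : Configuration H k} (hξ : IsCentralConfiguration mt m ξ) (hBS : BSCondition mt m ξ)
    (hU : 0 < potential mt m ξ) {A : Configuration H k →L[ℝ] Configuration H k}
    (hA : HasFDerivAt (fun x => acceleration mt m (x, 0)) A ξ)
    {b : Configuration H k} (hb : b ≠ 0) {μ : ℝ} (hμ : A b = μ • b) :
    -(9 / 8) * potential mt m ξ < μ := by
  -- The eigenvector need not respect the splitting into `ξ` and its complement. If it is orthogonal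
  -- to `ξ`, `μ + U(ξ)` is a Hessian eigenvalue; otherwise symmetry against `ξ` forces `μ = 2U(ξ)`.
  by_cases h : massInner m ξ b = 0
  · obtain ⟨ν, hν, hν'⟩ := hBS
    have h1 : IsHessianEigenvalue mt m ξ (μ + potential mt m ξ) := by
      refine ⟨b, hb, h, fun w hw => ?_⟩
      rw [hessianRestricted_eq hm hξ.1 hξ.2.1 hA h hw, hμ, massInner_smul_left]
      ring
    have h2 := hν.2 h1
    linarith
  · have h1 : A ξ = (2 * potential mt m ξ) • ξ := by
      rw [linearization_apply_self hA, acceleration_centralConfiguration hm hξ, smul_smul]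
      ring_nf
    have h2 := linearization_symmetric hm hξ.1 hA ξ b
    rw [h1, hμ, massInner_smul_left, massInner_smul_right] at h2
    have h3 := mul_right_cancel₀ h h2
    linarith

/-! ### Existence of a bounded profile -/

/-- Bounded perturbations `ψ` of a homothetic parabolic orbit, in logarithmic time. The field `F`
is linearized at `(ξ, 0)`, and all modes of the linearized equation are hyperbolic. -/
theorem exists_profile {V W ι : Type*} [NormedAddCommGroup V] [NormedSpace ℝ V]
    [NormedAddCommGroup W] [NormedSpace ℝ W] [Fintype ι] {F : V × W → V} {F' : V × W →L[ℝ] V}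
    {ξ : V} {G : Set (V × W)} (hG : IsOpen G) (hξ : (ξ, 0) ∈ G) (hFc : ContinuousOn F G)
    (hF : HasStrictFDerivAt F F' (ξ, 0)) (b : Module.Basis ι ℝ V) (μ : ι → ℝ)
    (hb : ∀ i, F' (b i, 0) = μ i • b i) {c : ℝ} (hc : 0 < c) (hμ : ∀ i, 0 < 1 / 4 + c * μ i) :
    ∃ θ > 0, ∀ γ : ℝ → W, Continuous γ → (∀ u, 0 ≤ u → ‖γ u‖ ≤ θ * Real.exp (-(2 / 3 * u))) →
      ∀ y : V, ‖y - ξ‖ ≤ θ → ∃ ψ ψ' : ℝ → V, ψ 0 = y - ξ ∧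
        (∃ C, ∀ u, 0 ≤ u → ‖ψ u‖ ≤ C ∧ ‖ψ' u‖ ≤ C) ∧
        ∀ u, 0 ≤ u → (ξ + Real.exp (-(u / 6)) • ψ u, γ u) ∈ G ∧ HasDerivAt ψ (ψ' u) u ∧
          HasDerivAt ψ' ((1 / 4 : ℝ) • ψ u + (c * Real.exp (u / 6)) •
            (F (ξ + Real.exp (-(u / 6)) • ψ u, γ u) - F (ξ, 0))) u := by
  have : FiniteDimensional ℝ V := b.finiteDimensional_of_finite
  let B : (ι → ℝ) ≃L[ℝ] V := b.equivFunL.symm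
  obtain ⟨K₁, hK₁, hB₁⟩ : ∃ K > 0, ∀ x, ‖B x‖ ≤ K * ‖x‖ :=
    (B : (ι → ℝ) →L[ℝ] V).isBoundedLinearMap.bound
  obtain ⟨K₂, hK₂, hB₂⟩ : ∃ K > 0, ∀ x, ‖B.symm x‖ ≤ K * ‖x‖ :=
    (B.symm : V →L[ℝ] (ι → ℝ)).isBoundedLinearMap.bound
  obtain ⟨K₃, hK₃, hF₃⟩ : ∃ K > 0, ∀ x, ‖F' x‖ ≤ K * ‖x‖ := F'.isBoundedLinearMap.bound
  let δ : ι → ℝ := fun i => √(1 / 4 + c * μ i)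
  have hδ : ∀ i, 0 < δ i := fun i => Real.sqrt_pos.2 (hμ i)
  have hδ2 : ∀ i, δ i ^ 2 = 1 / 4 + c * μ i := fun i => Real.sq_sqrt (hμ i).le
  have hδinv : ∀ i, 0 < 1 / δ i ^ 2 := fun i => by have := hδ i; positivity
  obtain ⟨κ, hκ0, hκ⟩ : ∃ κ > 0, ∀ i, 1 / δ i ^ 2 ≤ κ :=
    ⟨1 + ∑ i, 1 / δ i ^ 2, add_pos_of_pos_of_nonneg one_pos
      (Finset.sum_nonneg fun i _ => (hδinv i).le), fun i =>
      (Finset.single_le_sum (fun i _ => (hδinv i).le) (Finset.mem_univ i)).trans (by linarith)⟩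
  have hAB : ∀ x, F' (B x, 0) = B (fun i => μ i * x i) := fun x => by
    have h1 : ∀ x, B x = ∑ i, x i • b i := fun x => b.equivFun_symm_apply x
    have h2 : F' (B x, 0) = (F'.comp (ContinuousLinearMap.inl ℝ V W)) (B x) := by simp
    rw [h2, h1, h1, map_sum]
    refine Finset.sum_congr rfl fun i _ => ?_
    rw [map_smul, ContinuousLinearMap.comp_apply, ContinuousLinearMap.inl_apply, hb, smul_smul,
      mul_comm]
  -- Chosen so that `κ` times the Lipschitz constant `c K₂ ε₁ K₁` of the nonlinearity is exactly
  -- `1/2`.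
  let ε₁ : ℝ := 1 / (2 * κ * c * K₁ * K₂)
  have hε₁ : 0 < ε₁ := by positivity
  obtain ⟨s, hs, hsF⟩ := hF.approximates_deriv_on_nhds (c := ε₁.toNNReal)
    (Or.inr (Real.toNNReal_pos.2 hε₁))
  obtain ⟨r, hr, hball⟩ := Metric.mem_nhds_iff.1 (Filter.inter_mem hs (hG.mem_nhds hξ))
  have hmem : ∀ z w, ‖z‖ < r → ‖w‖ < r → (ξ + z, w) ∈ s ∩ G := fun z w hz hw => hball (by
    rw [Metric.mem_ball, dist_eq_norm, Prod.mk_sub_mk, add_sub_cancel_left, sub_zero]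
    exact max_lt hz hw)
  let Q : V → W → V := fun z w => F (ξ + z, w) - F (ξ, 0) - F' (z, 0)
  have hQlip : ∀ z₁ z₂ w, ‖z₁‖ < r → ‖z₂‖ < r → ‖w‖ < r →
      ‖Q z₁ w - Q z₂ w‖ ≤ ε₁ * ‖z₁ - z₂‖ := fun z₁ z₂ w h₁ h₂ hw => by
    have h := hsF _ (hmem z₁ w h₁ hw).1 _ (hmem z₂ w h₂ hw).1
    have e : ((ξ + z₁, w) : V × W) - (ξ + z₂, w) = (z₁, 0) - (z₂, 0) := by ext <;> simp
    have e' : ‖((z₁, 0) : V × W) - (z₂, 0)‖ = ‖z₁ - z₂‖ := by simp [Prod.norm_def]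
    rw [e, e', map_sub, Real.coe_toNNReal _ hε₁.le] at h
    convert h using 2
    simp only [Q]
    abel
  have hQ0 : ∀ w, ‖w‖ < r → ‖Q 0 w‖ ≤ (ε₁ + K₃) * ‖w‖ := fun w hw => by
    have h := hsF _ (hmem 0 w (by simpa using hr) hw).1 _
      (hmem 0 0 (by simpa using hr) (by simpa using hr)).1
    have e : ((ξ + 0, w) : V × W) - (ξ + 0, 0) = (0, w) := by ext <;> simp
    have e' : ‖((0, w) : V × W)‖ = ‖w‖ := by simp [Prod.norm_def]
    rw [e, e', Real.coe_toNNReal _ hε₁.le] at h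
    have h1 := hF₃ (0, w)
    rw [e'] at h1
    have e2 : Q 0 w = (F (ξ + 0, w) - F (ξ + 0, 0) - F' (0, w)) + F' (0, w) := by
      have : F' ((0 : V), (0 : W)) = 0 := F'.map_zero
      simp [Q, this]
    rw [e2, add_mul]
    exact (norm_add_le _ _).trans (add_le_add h h1)
  let ρ : ℝ := r / (2 * K₁)
  have hρ : 0 < ρ := by positivity
  have hρr : K₁ * ρ < r := by
    have : K₁ * ρ = r / 2 := by simp only [ρ]; field_simp
    linarith
  -- The three bounds keep `γ` inside the ball of radius `r`, the initial position below `ρ/4`, and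
  -- `κ β` below `ρ/4`; the solution then stays within `2(ρ/4 + ρ/4) = ρ`.
  let θ : ℝ := min (r / 2) (min (ρ / (4 * K₂)) (ρ / (4 * κ * c * K₂ * (ε₁ + K₃))))
  have hθ : 0 < θ := by positivity
  refine ⟨θ, hθ, fun γ hγc hγ y hy => ?_⟩
  -- Clamping coordinates is 1-Lipschitz in the sup norm, so the local estimates on `Q` become
  -- global. The solution never leaves the region where `P` is the identity.
  let P : (ι → ℝ) → ι → ℝ := fun x i => max (-ρ) (min ρ (x i))
  have hPc : Continuous P := by fun_prop
  have hPn : ∀ x, ‖P x‖ ≤ ρ := fun x => (pi_norm_le_iff_of_nonneg hρ.le).2 fun i =>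
    abs_le.2 ⟨le_max_left _ _, max_le (by linarith) (min_le_left _ _)⟩
  have hPlip : ∀ x y, ‖P x - P y‖ ≤ ‖x - y‖ := fun x y =>
    (pi_norm_le_iff_of_nonneg (norm_nonneg _)).2 fun i => by
      refine le_trans ?_ (norm_le_pi_norm (x - y) i)
      refine (abs_max_sub_max_le_max _ _ _ _).trans ?_
      rw [sub_self, abs_zero, max_eq_right (abs_nonneg _)]
      refine (abs_min_sub_min_le_max _ _ _ _).trans ?_
      rw [sub_self, abs_zero, max_eq_right (abs_nonneg _)]
      rfl
  have hPid : ∀ x, ‖x‖ ≤ ρ → P x = x := fun x hx => funext fun i => by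
    have := abs_le.1 ((norm_le_pi_norm x i).trans hx)
    simp only [P]
    rw [min_eq_right this.2, max_eq_right this.1]
  have hγr : ∀ u, ‖γ (max u 0)‖ < r := fun u => by
    refine (hγ _ (le_max_right u 0)).trans_lt ?_
    have h1 : Real.exp (-(2 / 3 * max u 0)) ≤ 1 := Real.exp_le_one_iff.2 (by
      have := le_max_right u 0; linarith)
    have h2 : θ ≤ r / 2 := min_le_left _ _
    nlinarith
  let Z : ℝ → (ι → ℝ) → V := fun u x => Real.exp (-(max u 0 / 6)) • B (P x)
  have hZn : ∀ u x, ‖Z u x‖ < r := fun u x => by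
    have h1 : Real.exp (-(max u 0 / 6)) ≤ 1 := Real.exp_le_one_iff.2 (by
      have := le_max_right u 0; linarith)
    rw [norm_smul, Real.norm_of_nonneg (Real.exp_pos _).le]
    calc _ ≤ 1 * (K₁ * ρ) := by
          refine mul_le_mul h1 ((hB₁ _).trans ?_) (norm_nonneg _) zero_le_one
          exact mul_le_mul_of_nonneg_left (hPn x) hK₁.le
      _ < r := by linarith
  let g : ℝ → (ι → ℝ) → ι → ℝ := fun u x =>
    (c * Real.exp (max u 0 / 6)) • B.symm (Q (Z u x) (γ (max u 0)))
  have hgc : Continuous fun p : ℝ × (ι → ℝ) => g p.1 p.2 := by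
    have hZc : Continuous fun p : ℝ × (ι → ℝ) => Z p.1 p.2 := by
      have : Continuous fun p : ℝ × (ι → ℝ) => B (P p.2) :=
        B.continuous.comp (hPc.comp continuous_snd)
      exact Continuous.smul (by fun_prop) this
    have h1 : Continuous fun p : ℝ × (ι → ℝ) => F (ξ + Z p.1 p.2, γ (max p.1 0)) :=
      hFc.comp_continuous (f := fun p : ℝ × (ι → ℝ) => (ξ + Z p.1 p.2, γ (max p.1 0)))
        (by fun_prop) fun p => (hmem _ _ (hZn _ _) (hγr _)).2
    have h2 : Continuous fun p : ℝ × (ι → ℝ) => F' (Z p.1 p.2, 0) :=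
      F'.continuous.comp (hZc.prodMk continuous_const)
    have h3 : Continuous fun p : ℝ × (ι → ℝ) => c * Real.exp (max p.1 0 / 6) := by fun_prop
    exact h3.smul (B.symm.continuous.comp ((h1.sub continuous_const).sub h2))
  -- The growing factor `e^{u/6}` is cancelled by the `e^{-u/6}` inside `Z`, which makes the bound
  -- uniform in `u`.
  have hglip : ∀ u x y, ‖g u x - g u y‖ ≤ (c * K₂ * ε₁ * K₁) * ‖x - y‖ := fun u x y => by
    have hcu : 0 < c * Real.exp (max u 0 / 6) := by positivity
    have h1 := hQlip (Z u x) (Z u y) (γ (max u 0)) (hZn _ _) (hZn _ _) (hγr _)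
    have h2 : ‖Z u x - Z u y‖ ≤ Real.exp (-(max u 0 / 6)) * (K₁ * ‖x - y‖) := by
      simp only [Z]
      rw [← smul_sub, ← map_sub, norm_smul, Real.norm_of_nonneg (Real.exp_pos _).le]
      gcongr
      exact (hB₁ _).trans (mul_le_mul_of_nonneg_left (hPlip x y) hK₁.le)
    simp only [g]
    rw [← smul_sub, ← map_sub, norm_smul, Real.norm_of_nonneg hcu.le]
    calc _ ≤ c * Real.exp (max u 0 / 6) *
          (K₂ * (ε₁ * (Real.exp (-(max u 0 / 6)) * (K₁ * ‖x - y‖)))) := by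
          gcongr
          exact (hB₂ _).trans (mul_le_mul_of_nonneg_left (h1.trans (by gcongr)) hK₂.le)
      _ = (Real.exp (max u 0 / 6) * Real.exp (-(max u 0 / 6))) *
          ((c * K₂ * ε₁ * K₁) * ‖x - y‖) := by ring
      _ = _ := by rw [← Real.exp_add, add_neg_cancel, Real.exp_zero, one_mul]
  -- Here the decay `e^{-2u/3}` of the primaries outweighs `e^{u/6}`.
  have hgβ : ∀ u, ‖g u 0‖ ≤ c * K₂ * (ε₁ + K₃) * θ := fun u => by
    have hcu : 0 < c * Real.exp (max u 0 / 6) := by positivity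
    have hu := le_max_right u 0
    have hZ0 : Z u 0 = 0 := by
      simp only [Z]
      rw [hPid 0 (by simpa using hρ.le), map_zero, smul_zero]
    simp only [g]
    rw [hZ0, norm_smul, Real.norm_of_nonneg hcu.le]
    calc _ ≤ c * Real.exp (max u 0 / 6) *
          (K₂ * ((ε₁ + K₃) * (θ * Real.exp (-(2 / 3 * max u 0))))) := by
          gcongr
          exact (hB₂ _).trans (mul_le_mul_of_nonneg_left
            ((hQ0 _ (hγr u)).trans (by gcongr; exact hγ _ hu)) hK₂.le)
      _ = (c * K₂ * (ε₁ + K₃) * θ) *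
          (Real.exp (max u 0 / 6) * Real.exp (-(2 / 3 * max u 0))) := by ring
      _ ≤ (c * K₂ * (ε₁ + K₃) * θ) * 1 := by
          gcongr
          rw [← Real.exp_add]
          exact Real.exp_le_one_iff.2 (by linarith)
      _ = _ := mul_one _
  obtain ⟨φ, φ', h0, hφ, ⟨C, hC⟩, hode⟩ := exists_bounded_solution δ hδ hκ0.le hκ
    (by positivity) (by
      simp only [ε₁]
      apply le_of_eq
      field_simp) g hgc hglip hgβ (B.symm (y - ξ))
  have hφρ : ∀ u, 0 ≤ u → ‖φ u‖ ≤ ρ := fun u hu => by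
    refine (hφ u hu).trans ?_
    have h1 : ‖B.symm (y - ξ)‖ ≤ ρ / 4 := by
      have h2 : θ ≤ ρ / (4 * K₂) := (min_le_right _ _).trans (min_le_left _ _)
      calc _ ≤ K₂ * (ρ / (4 * K₂)) :=
            (hB₂ _).trans (mul_le_mul_of_nonneg_left (hy.trans h2) hK₂.le)
        _ = ρ / 4 := by field_simp
    have h3 : κ * (c * K₂ * (ε₁ + K₃) * θ) ≤ ρ / 4 := by
      have h2 : θ ≤ ρ / (4 * κ * c * K₂ * (ε₁ + K₃)) := (min_le_right _ _).trans (min_le_right _ _)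
      calc _ ≤ κ * (c * K₂ * (ε₁ + K₃) * (ρ / (4 * κ * c * K₂ * (ε₁ + K₃)))) := by gcongr
        _ = ρ / 4 := by field_simp
    linarith
  refine ⟨fun u => B (φ u), fun u => B (φ' u), by simp [h0], ⟨max (K₁ * ρ) (K₁ * C),
    fun u hu => ⟨(hB₁ _).trans (le_max_of_le_left (mul_le_mul_of_nonneg_left (hφρ u hu) hK₁.le)),
      (hB₁ _).trans (le_max_of_le_right (mul_le_mul_of_nonneg_left (hC u hu) hK₁.le))⟩⟩,
    fun u hu => ?_⟩
  have hZu : Z u (φ u) = Real.exp (-(u / 6)) • B (φ u) := by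
    simp only [Z]
    rw [max_eq_left hu, hPid _ (hφρ u hu)]
  have hγu := hγr u
  rw [max_eq_left hu] at hγu
  refine ⟨?_, ?_, ?_⟩
  · rw [← hZu]
    exact (hmem _ _ (hZn u _) hγu).2
  · exact (B : (ι → ℝ) →L[ℝ] V).hasFDerivAt.comp_hasDerivAt u (hode u hu).1
  · refine ((B : (ι → ℝ) →L[ℝ] V).hasFDerivAt.comp_hasDerivAt u (hode u hu).2).congr_deriv ?_
    have e1 : (fun i => δ i ^ 2 * φ u i + g u (φ u) i) =
        (1 / 4 : ℝ) • φ u + (c • (fun i => μ i * φ u i) + g u (φ u)) := by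
      funext i
      simp only [hδ2, Pi.add_apply, Pi.smul_apply, smul_eq_mul]
      ring
    have e2 : F' (Z u (φ u), 0) = Real.exp (-(u / 6)) • F' (B (φ u), 0) := by
      rw [hZu, ← F'.map_smul, Prod.smul_mk, smul_zero]
    rw [e1, ContinuousLinearEquiv.coe_coe, map_add, map_add, map_smul, map_smul, ← hAB]
    congr 1
    simp only [g]
    rw [map_smul, ContinuousLinearEquiv.apply_symm_apply, max_eq_left hu]
    simp only [Q]
    rw [e2, hZu, smul_sub _ _ (Real.exp (-(u / 6)) • _), smul_smul, mul_assoc, ← Real.exp_add,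
      add_neg_cancel, Real.exp_zero, mul_one]
    abel

/-! ### Cones, and the return to physical time -/

/-- A cone with a small enough opening angle about `ξ` is close to the ray of `ξ`. -/
lemma exists_cone_close {m : Fin H → ℝ} (hm : ∀ j, 0 < m j) {ξ : Configuration H k}
    (hξ : massNorm m ξ = 1) {θ : ℝ} (hθ : 0 < θ) {η : ℝ} (hη : η < 1) :
    ∃ η' ∈ Set.Ico η 1, ∀ y : Configuration H k, massNorm m y = 1 → η' < massInner m y ξ →
      ‖y - ξ‖ ≤ θ := by
  have h1 : ∀ᶠ s in 𝓝[<] (1 : ℝ), ∀ j, 2 - 2 * s < m j * θ ^ 2 := by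
    refine eventually_all.2 fun j => ?_
    have hc : Tendsto (fun s : ℝ => 2 - 2 * s) (𝓝[<] 1) (𝓝 (2 - 2 * 1)) :=
      (Continuous.tendsto (by fun_prop) 1).mono_left nhdsWithin_le_nhds
    refine hc.eventually (gt_mem_nhds ?_)
    have := hm j
    norm_num
    positivity
  have h2 : ∀ᶠ s in 𝓝[<] (1 : ℝ), s ∈ Set.Ico η 1 := Ico_mem_nhdsLT hη
  obtain ⟨s, hs, hsη⟩ := (h1.and h2).exists
  refine ⟨s, hsη, fun y hy hyξ => (pi_norm_le_iff_of_nonneg hθ.le).2 fun j => ?_⟩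
  have h3 : massInner m (y - ξ) (y - ξ) = 2 - 2 * massInner m y ξ := by
    have e1 : massInner m y y = 1 := by rw [← massNorm_sq hm, hy, one_pow]
    have e2 : massInner m ξ ξ = 1 := by rw [← massNorm_sq hm, hξ, one_pow]
    have e3 := massInner_comm m ξ y
    simp only [← massForm_apply, map_sub, sub_apply] at *
    rw [e1, e2, e3]
    ring
  have h4 : m j * ‖(y - ξ) j‖ ^ 2 ≤ massInner m (y - ξ) (y - ξ) := by
    rw [← real_inner_self_eq_norm_sq]
    exact Finset.single_le_sum (f := fun j => m j * inner ℝ ((y - ξ) j) ((y - ξ) j))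
      (fun j _ => mul_nonneg (hm j).le real_inner_self_nonneg) (Finset.mem_univ j)
  have h5 : m j * ‖(y - ξ) j‖ ^ 2 ≤ m j * θ ^ 2 := by linarith [hs j]
  exact le_of_sq_le_sq (le_of_mul_le_mul_left h5 (hm j)) hθ.le

/-- The orbit with profile `ψ` about the homothetic parabolic orbit of `ξ`, as a function of the
logarithmic time `u`. -/
def profileOrbit {V : Type*} [AddCommGroup V] [Module ℝ V] (lam : ℝ) (ξ : V) (ψ : ℝ → V)
    (u : ℝ) : V :=
  (lam * Real.exp (2 / 3 * u)) • (ξ + Real.exp (-(u / 6)) • ψ u)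

/-- The velocity of `profileOrbit`, with respect to physical time. -/
def profileVelocity {V : Type*} [AddCommGroup V] [Module ℝ V] (lam τ : ℝ) (ξ : V) (ψ ψ' : ℝ → V)
    (u : ℝ) : V :=
  (lam / τ) • ((2 / 3 * Real.exp (-(u / 3))) • ξ +
    Real.exp (-(u / 2)) • ((1 / 2 : ℝ) • ψ u + ψ' u))

lemma hasDerivAt_exp_const_mul (a u : ℝ) :
    HasDerivAt (fun u : ℝ => Real.exp (a * u)) (a * Real.exp (a * u)) u := by
  have := ((hasDerivAt_id u).const_mul a).exp
  simpa [mul_comm] using this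

section Profile

variable {V : Type*} [NormedAddCommGroup V] [NormedSpace ℝ V] {lam τ : ℝ} {ξ : V} {ψ ψ' : ℝ → V}

lemma hasDerivAt_logTime (hτ : 0 < τ) {t : ℝ} (ht : 0 ≤ t) :
    HasDerivAt (fun t => Real.log (1 + t / τ)) (τ⁻¹ * Real.exp (-Real.log (1 + t / τ))) t := by
  have hpos : 0 < 1 + t / τ := by positivity
  refine ((((hasDerivAt_id t).div_const τ).const_add 1).log hpos.ne').congr_deriv ?_
  rw [Real.exp_neg, Real.exp_log hpos]
  simp [div_eq_mul_inv]

lemma hasDerivAt_profileOrbit (hτ : 0 < τ) {t : ℝ} (ht : 0 ≤ t)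
    (hψ : HasDerivAt ψ (ψ' (Real.log (1 + t / τ))) (Real.log (1 + t / τ))) :
    HasDerivAt (fun t => profileOrbit lam ξ ψ (Real.log (1 + t / τ)))
      (profileVelocity lam τ ξ ψ ψ' (Real.log (1 + t / τ))) t := by
  have hu := hasDerivAt_logTime hτ ht
  set u := Real.log (1 + t / τ)
  have h1 : HasDerivAt (fun u => lam • (Real.exp (2 / 3 * u) • ξ + Real.exp (1 / 2 * u) • ψ u))
      (lam • ((2 / 3 * Real.exp (2 / 3 * u)) • ξ + (Real.exp (1 / 2 * u) • ψ' u +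
        (1 / 2 * Real.exp (1 / 2 * u)) • ψ u))) u :=
    (((hasDerivAt_exp_const_mul _ u).smul_const ξ).fun_add
      ((hasDerivAt_exp_const_mul _ u).fun_smul hψ)).const_smul lam
  have e : profileOrbit lam ξ ψ =
      fun u => lam • (Real.exp (2 / 3 * u) • ξ + Real.exp (1 / 2 * u) • ψ u) := by
    funext u
    rw [profileOrbit, mul_smul, smul_add, smul_smul, ← Real.exp_add]
    ring_nf
  rw [← e] at h1
  refine (HasDerivAt.scomp t h1 hu).congr_deriv ?_
  have e1 : Real.exp (2 / 3 * u) = Real.exp u * Real.exp (-(u / 3)) := by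
    rw [← Real.exp_add]; ring_nf
  have e2 : Real.exp (1 / 2 * u) = Real.exp u * Real.exp (-(u / 2)) := by
    rw [← Real.exp_add]; ring_nf
  have e3 : Real.exp (-u) * Real.exp u = 1 := by rw [← Real.exp_add]; simp
  rw [profileVelocity, e1, e2]
  have e4 : Real.exp u ≠ 0 := (Real.exp_pos u).ne'
  rw [Real.exp_neg u]
  match_scalars <;> field_simp

/-- As `d/dt = τ⁻¹ e^{-u} d/du`, the second derivative of `e^{u/2} ψ` is `τ⁻² e^{-3u/2} (ψ'' -
ψ/4)`: the `ψ'` terms cancel. That of `e^{2u/3} ξ` is `-(2/9) τ⁻² e^{-4u/3} ξ`, which the shift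
`(2/9/c) ξ` compensates. -/
lemma hasDerivAt_profileVelocity (hτ : 0 < τ) {t : ℝ} (ht : 0 ≤ t) {c : ℝ}
    (hτ2 : τ ^ 2 = c * lam ^ 3) (hlam : 0 < lam) {f : V}
    (hψ : HasDerivAt ψ (ψ' (Real.log (1 + t / τ))) (Real.log (1 + t / τ)))
    (hψ' : HasDerivAt ψ' ((1 / 4 : ℝ) • ψ (Real.log (1 + t / τ)) +
      (c * Real.exp (Real.log (1 + t / τ) / 6)) • (f + (2 / 9 / c) • ξ))
      (Real.log (1 + t / τ))) :
    HasDerivAt (fun t => profileVelocity lam τ ξ ψ ψ' (Real.log (1 + t / τ)))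
      (((lam * Real.exp (2 / 3 * Real.log (1 + t / τ))) ^ 2)⁻¹ • f) t := by
  have hc : 0 < c := by
    have : 0 < c * lam ^ 3 := hτ2 ▸ by positivity
    exact pos_of_mul_pos_left this (by positivity)
  have hu := hasDerivAt_logTime hτ ht
  set u := Real.log (1 + t / τ)
  have h1 : HasDerivAt (fun u => (lam / τ) • ((2 / 3 : ℝ) • (Real.exp (-(1 / 3) * u) • ξ) +
      Real.exp (-(1 / 2) * u) • ((1 / 2 : ℝ) • ψ u + ψ' u))) _ u :=
    ((((hasDerivAt_exp_const_mul _ u).smul_const ξ).const_smul (2 / 3 : ℝ)).fun_add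
      ((hasDerivAt_exp_const_mul _ u).fun_smul ((hψ.const_smul (1 / 2 : ℝ)).fun_add hψ'))).const_smul
      (lam / τ)
  have e : profileVelocity lam τ ξ ψ ψ' = fun u => (lam / τ) • ((2 / 3 : ℝ) •
      (Real.exp (-(1 / 3) * u) • ξ) + Real.exp (-(1 / 2) * u) • ((1 / 2 : ℝ) • ψ u + ψ' u)) := by
    funext u
    rw [profileVelocity, smul_smul]
    ring_nf
  rw [← e] at h1
  refine (HasDerivAt.scomp t h1 hu).congr_deriv ?_
  have e0 : 0 < Real.exp (u / 6) := Real.exp_pos _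
  have e1 : Real.exp (2 / 3 * u) = Real.exp (u / 6) ^ 4 := by
    rw [← Real.exp_nat_mul]; ring_nf
  have e2 : Real.exp (-(1 / 3) * u) = (Real.exp (u / 6) ^ 2)⁻¹ := by
    rw [← Real.exp_nat_mul, ← Real.exp_neg]; ring_nf
  have e3 : Real.exp (-(1 / 2) * u) = (Real.exp (u / 6) ^ 3)⁻¹ := by
    rw [← Real.exp_nat_mul, ← Real.exp_neg]; ring_nf
  have e4 : Real.exp (-u) = (Real.exp (u / 6) ^ 6)⁻¹ := by
    rw [← Real.exp_nat_mul, ← Real.exp_neg]; ring_nf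
  rw [e1, e2, e3, e4]
  generalize Real.exp (u / 6) = E at *
  rw [Pi.smul_apply]
  match_scalars <;> field_simp <;> first | ring1 | (rw [hτ2]; ring1)

lemma tendsto_logTime (hτ : 0 < τ) : Tendsto (fun t => Real.log (1 + t / τ)) atTop atTop :=
  Real.tendsto_log_atTop.comp (tendsto_atTop_add_const_left _ _ (tendsto_id.atTop_div_const hτ))

lemma tendsto_exp_neg_smul {a C : ℝ} (ha : 0 < a) {f : ℝ → V} (hf : ∀ u, 0 ≤ u → ‖f u‖ ≤ C) :
    Tendsto (fun u => Real.exp (-(a * u)) • f u) atTop (𝓝 0) := by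
  refine squeeze_zero_norm' (a := fun u => Real.exp (-(a * u)) * C) ?_ ?_
  · filter_upwards [eventually_ge_atTop 0] with u hu
    rw [norm_smul, Real.norm_of_nonneg (Real.exp_pos _).le]
    exact mul_le_mul_of_nonneg_left (hf u hu) (Real.exp_pos _).le
  · have : Tendsto (fun u : ℝ => Real.exp (-(a * u))) atTop (𝓝 0) :=
      Real.tendsto_exp_neg_atTop_nhds_zero.comp (tendsto_id.const_mul_atTop ha)
    simpa using this.mul_const C

lemma tendsto_profileVelocity {C : ℝ} (hψ : ∀ u, 0 ≤ u → ‖ψ u‖ ≤ C ∧ ‖ψ' u‖ ≤ C) :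
    Tendsto (profileVelocity lam τ ξ ψ ψ') atTop (𝓝 0) := by
  have h1 := tendsto_exp_neg_smul (a := 1 / 3) (f := fun _ => (2 / 3 : ℝ) • ξ) (by norm_num)
    (fun u _ => le_rfl)
  have h2 := tendsto_exp_neg_smul (a := 1 / 2) (f := fun u => (1 / 2 : ℝ) • ψ u + ψ' u)
    (C := 1 / 2 * C + C) (by norm_num) fun u hu => (norm_add_le _ _).trans (add_le_add (by
      rw [norm_smul, Real.norm_of_nonneg (by norm_num)]
      exact mul_le_mul_of_nonneg_left (hψ u hu).1 (by norm_num)) (hψ u hu).2)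
  have h3 := (h1.add h2).const_smul (lam / τ)
  rw [add_zero, smul_zero] at h3
  refine h3.congr fun u => ?_
  rw [profileVelocity, smul_smul]
  ring_nf

end Profile

/-- `lam (1 + t / τ)^{2/3} ~ c^{-1/3} t^{2/3}` if `τ² = c lam³`. -/
lemma isEquivalent_scale {lam τ c : ℝ} (hlam : 0 < lam) (hτ : 0 < τ) (hc : 0 < c)
    (hτ2 : τ ^ 2 = c * lam ^ 3) :
    (fun t => lam * Real.exp (2 / 3 * Real.log (1 + t / τ))) ~[atTop]
      fun t => (c⁻¹) ^ (1 / 3 : ℝ) * t ^ (2 / 3 : ℝ) := by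
  -- Real powers preserve equivalence for functions that are nonnegative everywhere, hence the
  -- truncation at 0.
  have h1 : (fun t : ℝ => max (t + τ) 0) ~[atTop] fun t : ℝ => max t 0 := by
    have h2 : (fun t : ℝ => t + τ) ~[atTop] fun t : ℝ => t :=
      IsEquivalent.refl.add_isLittleO (isLittleO_const_id_atTop τ)
    refine (h2.congr_left ?_).congr_right ?_
    · filter_upwards [eventually_ge_atTop 0] with t ht
      rw [max_eq_left (by positivity)]
    · filter_upwards [eventually_ge_atTop 0] with t ht
      rw [max_eq_left ht]
  have h3 := (IsEquivalent.refl (u := fun _ : ℝ => (c⁻¹) ^ (1 / 3 : ℝ)) (l := atTop)).mul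
    (h1.rpow (r := 2 / 3) (show (0 : ℝ → ℝ) ≤ fun t => max t 0 from fun t => le_max_right _ _))
  refine (h3.congr_left ?_).congr_right ?_
  · filter_upwards [eventually_ge_atTop 0] with t ht
    have hpos : 0 < 1 + t / τ := by positivity
    have e1 : Real.exp (2 / 3 * Real.log (1 + t / τ)) = (1 + t / τ) ^ (2 / 3 : ℝ) := by
      rw [Real.rpow_def_of_pos hpos, mul_comm]
    have e2 : lam = (c⁻¹) ^ (1 / 3 : ℝ) * τ ^ (2 / 3 : ℝ) := by
      have e3 : τ ^ (2 / 3 : ℝ) = (c * lam ^ 3) ^ (1 / 3 : ℝ) := by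
        rw [← hτ2, ← Real.rpow_natCast, ← Real.rpow_mul hτ.le]
        norm_num
      rw [e3, ← Real.mul_rpow (by positivity) (by positivity), inv_mul_cancel_left₀ hc.ne',
        ← Real.rpow_natCast, ← Real.rpow_mul hlam.le]
      norm_num
    simp only [Pi.mul_apply, Pi.pow_apply]
    rw [max_eq_left (by positivity), e1]
    conv_rhs => rw [e2]
    rw [mul_assoc, ← Real.mul_rpow hτ.le hpos.le]
    congr 2
    field_simp
    ring
  · filter_upwards [eventually_ge_atTop 0] with t ht
    simp only [Pi.mul_apply, Pi.pow_apply]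
    rw [max_eq_left ht]

lemma acceleration_spec (mt : Fin N → ℝ) {m : Fin H → ℝ} (hm : ∀ j, 0 < m j)
    (q : Configuration H k) (c : Fin N → EuclideanSpace ℝ (Fin k)) (j : Fin H) :
    m j • acceleration mt m (q, c) j = force mt m c q j := by
  simp only [acceleration]
  rw [smul_smul, mul_inv_cancel₀ (hm j).ne', one_smul]

/-- A parabolic solution starting close to the ray of `ξ`, from a bounded profile. -/
lemma exists_parabolic_of_profile {mt : Fin N → ℝ} {m : Fin H → ℝ} (hm : ∀ j, 0 < m j)
    {ξ : Configuration H k} (hξ : IsCentralConfiguration mt m ξ) (hU : 0 < potential mt m ξ)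
    (c : Fin N → ℝ → EuclideanSpace ℝ (Fin k)) {lam τ : ℝ} (hlam : 0 < lam) (hτ : 0 < τ)
    (hτ2 : τ ^ 2 = 2 / (9 * potential mt m ξ) * lam ^ 3) {ψ ψ' : ℝ → Configuration H k}
    {γ : ℝ → Fin N → EuclideanSpace ℝ (Fin k)}
    (hγ : ∀ u i, γ u i = (lam * Real.exp (2 / 3 * u))⁻¹ • c i (τ * (Real.exp u - 1)))
    (hC : ∃ C, ∀ u, 0 ≤ u → ‖ψ u‖ ≤ C ∧ ‖ψ' u‖ ≤ C)
    (hψ : ∀ u, 0 ≤ u → (ξ + Real.exp (-(u / 6)) • ψ u, γ u) ∈ collisionFree N H k ∧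
      HasDerivAt ψ (ψ' u) u ∧ HasDerivAt ψ' ((1 / 4 : ℝ) • ψ u +
        (2 / (9 * potential mt m ξ) * Real.exp (u / 6)) •
        (acceleration mt m (ξ + Real.exp (-(u / 6)) • ψ u, γ u) - acceleration mt m (ξ, 0))) u) :
    ∃ x : ℝ → Configuration H k, IsParabolicSolution mt m c x ∧ x 0 = lam • (ξ + ψ 0) ∧
      Tendsto (fun t => (massNorm m (x t))⁻¹ • x t) atTop (𝓝 ξ) ∧
      (fun t => massNorm m (x t)) ~[atTop]
        (fun t => (9 * potential mt m ξ / 2) ^ (1 / 3 : ℝ) * t ^ (2 / 3 : ℝ)) := by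
  obtain ⟨C, hC⟩ := hC
  have hc : 0 < 2 / (9 * potential mt m ξ) := by positivity
  let L : ℝ → ℝ := fun t => Real.log (1 + t / τ)
  have hL : Tendsto L atTop atTop := tendsto_logTime hτ
  have hL0 : ∀ t, 0 ≤ t → 0 ≤ L t := fun t ht =>
    Real.log_nonneg (by have : 0 ≤ t / τ := by positivity
                        linarith)
  have hLexp : ∀ t, 0 ≤ t → τ * (Real.exp (L t) - 1) = t := fun t ht => by
    have : 0 < 1 + t / τ := by positivity
    simp only [L]
    rw [Real.exp_log this]
    field_simp
    ring
  let s : ℝ → ℝ := fun t => lam * Real.exp (2 / 3 * L t)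
  have hs : ∀ t, 0 < s t := fun t => by positivity
  let y : ℝ → Configuration H k := fun t => ξ + Real.exp (-(L t / 6)) • ψ (L t)
  -- Bodies and primaries are rescaled together, so joint homogeneity and scale invariance of
  -- collision-freeness apply.
  have hpair : ∀ t, 0 ≤ t → (profileOrbit lam ξ ψ (L t), fun i => c i t) = s t • (y t, γ (L t)) :=
    fun t ht => by
      refine Prod.ext rfl (funext fun i => ?_)
      simp only [Prod.smul_snd, Pi.smul_apply]
      rw [hγ, hLexp t ht, smul_smul, mul_inv_cancel₀ (hs t).ne', one_smul]
  have hy : Tendsto y atTop (𝓝 ξ) := by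
    have h1 := (tendsto_exp_neg_smul (a := 1 / 6) (by norm_num) fun u hu => (hC u hu).1).comp hL
    have h2 := h1.const_add ξ
    rw [add_zero] at h2
    refine h2.congr fun t => ?_
    simp only [y, Function.comp_apply]
    ring_nf
  have hyn : Tendsto (fun t => massNorm m (y t)) atTop (𝓝 1) := by
    have := ((continuous_massNorm m).tendsto ξ).comp hy
    rwa [hξ.2.1] at this
  have hxn : ∀ t, massNorm m (profileOrbit lam ξ ψ (L t)) = s t * massNorm m (y t) := fun t =>
    massNorm_smul m (hs t).le (y t)
  have hasymp : (fun t => massNorm m (profileOrbit lam ξ ψ (L t))) ~[atTop]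
      (fun t => (9 * potential mt m ξ / 2) ^ (1 / 3 : ℝ) * t ^ (2 / 3 : ℝ)) := by
    have h1 := (isEquivalent_scale hlam hτ hc hτ2).mul
      ((isEquivalent_const_iff_tendsto one_ne_zero).2 hyn)
    rw [inv_div] at h1
    refine (h1.congr_left (Eventually.of_forall fun t => (hxn t).symm)).congr_right
      (Eventually.of_forall fun t => ?_)
    simp
  refine ⟨fun t => profileOrbit lam ξ ψ (L t), ⟨fun t => profileVelocity lam τ ξ ψ ψ' (L t),
    ⟨fun t => acceleration mt m (profileOrbit lam ξ ψ (L t), fun i => c i t), fun t ht => ?_⟩,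
    ?_, ?_⟩, ?_, ?_, hasymp⟩
  · obtain ⟨h1, h2, h3⟩ := hψ (L t) (hL0 t ht)
    have h4 := smul_mem_collisionFree h1 (hs t).ne'
    rw [← hpair t ht] at h4
    refine ⟨h4.1, h4.2, (hasDerivAt_profileOrbit hτ ht h2).hasDerivWithinAt, ?_,
      fun j => acceleration_spec mt hm _ _ j⟩
    beta_reduce
    rw [hpair t ht, acceleration_smul mt m (hs t)]
    refine (hasDerivAt_profileVelocity hτ ht hτ2 hlam h2 (h3.congr_deriv ?_)).hasDerivWithinAt
    rw [acceleration_centralConfiguration hm hξ, neg_smul, sub_neg_eq_add]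
    congr 4
    field_simp
  · refine hasymp.symm.tendsto_atTop ?_
    exact (tendsto_rpow_atTop (by norm_num)).const_mul_atTop (by positivity)
  · exact (tendsto_profileVelocity hC).comp hL
  · simp [L, profileOrbit]
  · have h1 := (hyn.inv₀ one_ne_zero).smul hy
    rw [inv_one, one_smul] at h1
    refine h1.congr fun t => ?_
    rw [hxn]
    change _ = (s t * massNorm m (y t))⁻¹ • s t • y t
    rw [smul_smul, mul_inv, mul_right_comm, inv_mul_cancel₀ (hs t).ne', one_mul]

end RestrictedNBody

end

/-! ### Choice of the cone and conclusion -/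

open RestrictedNBody

theorem corollary6p2 (N H k : ℕ) (hN : 2 ≤ N) (hH : 2 ≤ H) (hk : 2 ≤ k)
    (mt : Fin N → ℝ) (hmt : ∀ i, 0 < mt i) (m : Fin H → ℝ) (hm : ∀ j, 0 < m j)
    (c : Fin N → ℝ → EuclideanSpace ℝ (Fin k)) (hc : ∀ i, Continuous (c i))
    (Ξ : ℝ) (hΞ : 0 < Ξ)
    (hcΞ : ∀ i, BddAbove (Set.range fun t => ‖c i t‖) ∧ (⨆ t, ‖c i t‖) < Ξ)
    (ξ : RestrictedNBody.Configuration H k)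
    (hξ : RestrictedNBody.IsCentralConfiguration mt m ξ)
    (hBS : RestrictedNBody.BSCondition mt m ξ)
    (η : ℝ) (hη : η ∈ Set.Ioo (0 : ℝ) 1) :
    ∃ R' > Ξ + 1, ∃ η' ∈ Set.Ico η 1,
      RestrictedNBody.truncatedCone m ξ R' η' ⊆ RestrictedNBody.domain H k ∧
      ∀ x₀ ∈ RestrictedNBody.truncatedCone m ξ R' η',
        ∃ x : ℝ → RestrictedNBody.Configuration H k,
          RestrictedNBody.IsParabolicSolution mt m c x ∧
          x 0 = x₀ ∧
          Tendsto (fun t => (RestrictedNBody.massNorm m (x t))⁻¹ • x t) atTop (𝓝 ξ) ∧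
          (fun t => RestrictedNBody.massNorm m (x t)) ~[atTop]
            (fun t => (9 * RestrictedNBody.potential mt m ξ / 2) ^ (1 / 3 : ℝ) *
              t ^ (2 / 3 : ℝ)) := by
  have hU : 0 < potential mt m ξ := potential_pos (by omega) (by omega) hmt hm hξ.1
  have hmem : (ξ, 0) ∈ collisionFree N H k := mem_collisionFree_of_mem_domain hξ.1
  have hF := (contDiffAt_acceleration mt m hmem).hasStrictFDerivAt one_ne_zero
  have hA := hasFDerivAt_acceleration_zero hF.hasFDerivAt
  obtain ⟨b, μ, hb⟩ := exists_eigenbasis (massCore hm) _ (linearization_symmetric hm hξ.1 hA)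
  -- The threshold `μ > -(9/8) U(ξ)` is exactly positivity of the squared rates `δ²`.
  have hμ : ∀ i, 0 < 1 / 4 + 2 / (9 * potential mt m ξ) * μ i := fun i => by
    have h1 := eigenvalue_linearization_gt hm hξ hBS hU hA (b.ne_zero i) (hb i)
    have h2 : 1 / 4 + 2 / (9 * potential mt m ξ) * μ i =
        (9 / 8 * potential mt m ξ + μ i) * (2 / (9 * potential mt m ξ)) := by
      field_simp
      ring
    rw [h2]
    exact mul_pos (by linarith) (by positivity)
  obtain ⟨θ, hθ, hprofile⟩ := exists_profile isOpen_collisionFree hmem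
    (fun p hp => (contDiffAt_acceleration mt m hp).continuousAt.continuousWithinAt) hF b μ hb
    (by positivity : 0 < 2 / (9 * potential mt m ξ)) hμ
  obtain ⟨θ', hθ', hdom⟩ := Metric.nhds_basis_closedBall.mem_iff.1 (isOpen_domain.mem_nhds hξ.1)
  obtain ⟨η', hη', hclose⟩ := exists_cone_close hm hξ.2.1 (lt_min hθ hθ') hη.2
  -- `Ξ + 2` secures `R' > Ξ + 1`; `Ξ / θ` makes the rescaled primaries start below `θ`. The radius
  -- `θ'` keeps the direction in `Σ`, which is invariant under scaling.
  have hdir : ∀ x₀ ∈ truncatedCone m ξ (max (Ξ + 2) (Ξ / θ)) η', 0 < massNorm m x₀ ∧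
      Ξ / θ < massNorm m x₀ ∧ ‖(massNorm m x₀)⁻¹ • x₀ - ξ‖ ≤ min θ θ' := fun x₀ hx₀ => by
    have h1 : max (Ξ + 2) (Ξ / θ) < massNorm m x₀ := hx₀.1
    have h2 : 0 < massNorm m x₀ := by linarith [le_max_left (Ξ + 2) (Ξ / θ)]
    refine ⟨h2, (le_max_right _ _).trans_lt h1, hclose _ ?_ hx₀.2⟩
    rw [massNorm_smul m (inv_pos.2 h2).le, inv_mul_cancel₀ h2.ne']
  refine ⟨max (Ξ + 2) (Ξ / θ), lt_max_of_lt_left (by linarith), η', hη', fun x₀ hx₀ => ?_,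
    fun x₀ hx₀ => ?_⟩
  · obtain ⟨h1, -, h3⟩ := hdir x₀ hx₀
    have h4 : (massNorm m x₀)⁻¹ • x₀ ∈ domain H k :=
      hdom (mem_closedBall_iff_norm.2 (h3.trans (min_le_right _ _)))
    have h5 := smul_mem_domain h4 h1.ne'
    rwa [smul_smul, mul_inv_cancel₀ h1.ne', one_smul] at h5
  · obtain ⟨h1, h2, h3⟩ := hdir x₀ hx₀
    set lam := massNorm m x₀
    set κ := 2 / (9 * potential mt m ξ)
    have hκ : 0 < κ := by positivity
    have hτ : 0 < √(κ * lam ^ 3) := Real.sqrt_pos.2 (by positivity)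
    have hτ2 : √(κ * lam ^ 3) ^ 2 = κ * lam ^ 3 := Real.sq_sqrt (by positivity)
    set τ := √(κ * lam ^ 3)
    let γ : ℝ → Fin N → EuclideanSpace ℝ (Fin k) := fun u i =>
      (lam * Real.exp (2 / 3 * u))⁻¹ • c i (τ * (Real.exp u - 1))
    have hγc : Continuous γ := continuous_pi fun i => by
      have h4 : Continuous fun u : ℝ => (lam * Real.exp (2 / 3 * u))⁻¹ :=
        Continuous.inv₀ (by fun_prop) fun u => (mul_pos h1 (Real.exp_pos _)).ne'
      have h5 : Continuous fun u : ℝ => τ * (Real.exp u - 1) := by fun_prop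
      exact h4.smul ((hc i).comp h5)
    have hγ : ∀ u, 0 ≤ u → ‖γ u‖ ≤ θ * Real.exp (-(2 / 3 * u)) := fun u _ => by
      refine (pi_norm_le_iff_of_nonneg (by positivity)).2 fun i => ?_
      have h4 : ‖c i (τ * (Real.exp u - 1))‖ ≤ Ξ :=
        (le_ciSup (hcΞ i).1 _).trans (hcΞ i).2.le
      have h5 : Ξ ≤ lam * θ := ((div_lt_iff₀ hθ).1 h2).le
      simp only [γ]
      rw [norm_smul, norm_inv, Real.norm_of_nonneg (by positivity), mul_inv, ← Real.exp_neg]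
      calc _ ≤ lam⁻¹ * Real.exp (-(2 / 3 * u)) * (lam * θ) := by
            gcongr
            exact h4.trans h5
        _ = θ * Real.exp (-(2 / 3 * u)) := by field_simp
    obtain ⟨ψ, ψ', h0, hC, hψ⟩ := hprofile γ hγc hγ (lam⁻¹ • x₀) (h3.trans (min_le_left _ _))
    obtain ⟨x, hx, hx0, hlim, has⟩ := exists_parabolic_of_profile hm hξ hU c h1 hτ hτ2
      (fun _ _ => rfl) hC hψ
    refine ⟨x, hx, ?_, hlim, has⟩
    rw [hx0, h0, add_sub_cancel, smul_smul, mul_inv_cancel₀ h1.ne', one_smul]
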